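/- Consider the $\mathcal{PT}$-symmetric Manakov system on $\mathbb{R}$, $$ \begin{aligned} i u_t &= -u_{xx} + \kappa v + i\gamma u - (g_{11}|u|^2 + g_{12}|v|^2)u,\\ i v_t &= -v_{xx} + \kappa u - i\gamma v - (g_{12}|u|^2 + g_{22}|v|^2)v, \end{aligned} $$ with real coefficients $g_{11} = g_{22} = g_{12}$ and $\kappa,\gamma \ge 0$. A global solution is a pair $(u,v) \in C(\mathbb{R}, H^1(\mathbb{R})\times H^1(\mathbb{R}))$ of complex-valued functions that satisfies the two equations in $H^{-1}(\mathbb{R})$ at every $t\in\mathbb{R}$. Put $Q(t) = \|u(t)\|_{L^2}^2 + \|v(t)\|_{L^2}^2$. (1) Let $\gamma < \kappa$. For every global solution there is a constant $Q_{\max} > 0$ such that $\sup_{t\in\mathbb{R}} Q(t) \le Q_{\max}$. Moreover, explicitly in terms of the data at $t=0$, $$ Q(t) \le \frac{\kappa C}{\omega^2} + \sqrt{A_1^2 + A_2^2} \quad\text{for all } t \in \mathbb{R}, $$ where $\omega = \sqrt{\kappa^2-\gamma^2}$, $C = \kappa Q(0) - \gamma S_2(0)$, $A_1 = Q(0) -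 \frac{\kappa C}{\omega^2}$, $A_2 = \frac{\gamma S_3(0)}{\omega}$, $S_2 = i\int_{\mathbb{R}} (\bar u v - u \bar v)\,dx$ and $S_3 = \int_{\mathbb{R}} (|u|^2-|v|^2)\,dx$. (2) Let $\gamma \ge \kappa$ and $\gamma > 0$. Then there exists a global solution such that $\lim_{t\to+\infty} Q(t) = \infty$. -/

import Mathlib

open MeasureTheory Filter Topology
open scoped SchwartzMap ComplexConjugate ENNReal

noncomputable section

/-- The complex Hilbert space `L²(ℝ)`. -/
abbrev L2 : Type := Lp ℂ 2 (volume : Measure ℝ)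

/-- The Sobolev space `H¹(ℝ)` of complex-valued functions, as a subspace: pairs `(f, f')` of `L²` functions such
that `f'` is the distributional derivative of `f`. As a submodule of the `ℓ²`-product of two copies
of `L²(ℝ)` it carries the norm `(‖f‖² + ‖f'‖²)^(1/2)`. -/
def sobolevH1 : Submodule ℂ (WithLp 2 (L2 × L2)) where
  carrier := {p | TemperedDistribution.derivCLM ℂ (Lp.toTemperedDistribution p.fst) =
    Lp.toTemperedDistribution p.snd}
  zero_mem' := by
    simp only [Set.mem_ofPred_eq, ← Lp.toTemperedDistributionCLM_apply, WithLp.zero_fst,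
      WithLp.zero_snd, map_zero]
  add_mem' := by
    intro p q hp hq
    simp only [Set.mem_ofPred_eq, ← Lp.toTemperedDistributionCLM_apply, WithLp.add_fst,
      WithLp.add_snd, map_add] at hp hq ⊢
    rw [hp, hq]
  smul_mem' := by
    intro c p hp
    simp only [Set.mem_ofPred_eq, ← Lp.toTemperedDistributionCLM_apply, WithLp.smul_fst,
      WithLp.smul_snd, map_smul] at hp ⊢
    rw [hp]

/-- The Sobolev space `H¹(ℝ)` as a normed space. -/
abbrev H1 : Type := sobolevH1

/-- The underlying `L²` function of an element of `H¹(ℝ)`. -/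
def H1.fn (f : H1) : L2 := f.val.fst

/-- The weak derivative of an element of `H¹(ℝ)`. -/
def H1.dx (f : H1) : L2 := f.val.snd

/-- `(u, v) ∈ C(ℝ, H¹(ℝ) × H¹(ℝ))` is a global solution of the generalized Manakov system
`i u_t = -u_xx + κ v + i γ u - (g₁₁|u|² + g₁₂|v|²) u`,
`i v_t = -v_xx + κ u - i γ v - (g₁₂|u|² + g₂₂|v|²) v`.
The equations hold at every time in `H⁻¹(ℝ)`, the dual of `H¹(ℝ)`: they are tested against every
`w ∈ H¹(ℝ)`, with `⟨-u_xx, w⟩ = ∫ u_x conj(w_x)`. (Mathlib's `inner ℂ w u` is `∫ u conj(w)`.) -/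
structure IsGlobalSolution (g₁₁ g₁₂ g₂₂ κ γ : ℝ) (u v : ℝ → H1) : Prop where
  continuous_u : Continuous u
  continuous_v : Continuous v
  eq_u : ∀ (t : ℝ) (w : H1),
    HasDerivAt (fun s => Complex.I * inner ℂ w.fn (u s).fn)
      (inner ℂ w.dx (u t).dx + κ * inner ℂ w.fn (v t).fn
        + Complex.I * γ * inner ℂ w.fn (u t).fn
        - ∫ x : ℝ, ((g₁₁ * ‖(u t).fn x‖ ^ 2 + g₁₂ * ‖(v t).fn x‖ ^ 2 : ℝ) : ℂ)
            * (u t).fn x * conj (w.fn x)) t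
  eq_v : ∀ (t : ℝ) (w : H1),
    HasDerivAt (fun s => Complex.I * inner ℂ w.fn (v s).fn)
      (inner ℂ w.dx (v t).dx + κ * inner ℂ w.fn (u t).fn
        - Complex.I * γ * inner ℂ w.fn (v t).fn
        - ∫ x : ℝ, ((g₁₂ * ‖(u t).fn x‖ ^ 2 + g₂₂ * ‖(v t).fn x‖ ^ 2 : ℝ) : ℂ)
            * (v t).fn x * conj (w.fn x)) t

/-- `Q = ‖u‖²_{L²} + ‖v‖²_{L²}`. -/
def totalPower (u v : H1) : ℝ := ‖u.fn‖ ^ 2 + ‖v.fn‖ ^ 2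

/-- The integral Stokes variable `S₂ = i ∫ (ū v - u v̄) dx` (a real number). -/
def stokes2 (u v : H1) : ℝ :=
  (Complex.I * ∫ x : ℝ, (conj (u.fn x) * v.fn x - u.fn x * conj (v.fn x))).re

/-- The integral Stokes variable `S₃ = ∫ (|u|² - |v|²) dx`. -/
def stokes3 (u v : H1) : ℝ := ∫ x : ℝ, (‖u.fn x‖ ^ 2 - ‖v.fn x‖ ^ 2)

/-- The explicit bound `Q_max = κ C / ω² + √(A₁² + A₂²)` computed from the initial data `(u₀, v₀)`,
where `ω = √(κ² - γ²)`, `C = κ Q(0) - γ S₂(0)`, `A₁ = Q(0) - κ C / ω²` and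
`A₂ = Q'(0) / (2ω)` with `Q'(0) = 2 γ S₃(0)`. It is meaningful for `γ < κ`. -/
def Qmax (κ γ : ℝ) (u₀ v₀ : H1) : ℝ :=
  let ω : ℝ := √(κ ^ 2 - γ ^ 2)
  let C : ℝ := κ * totalPower u₀ v₀ - γ * stokes2 u₀ v₀
  let A₁ : ℝ := totalPower u₀ v₀ - κ * C / ω ^ 2
  let A₂ : ℝ := 2 * γ * stokes3 u₀ v₀ / (2 * ω)
  κ * C / ω ^ 2 + √(A₁ ^ 2 + A₂ ^ 2)

end

/-! ### The Sobolev space `H¹(ℝ)` as a Hilbert space -/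

/-! Below the threshold: when all cubic coefficients agree, the nonlinearity multiplies `u` and `v`
by the same real function. It therefore drops out of the time derivatives of `‖u‖²`, `‖v‖²` and `Im
∫ u v̄`, and these obey a closed linear system with constant coefficients. For `γ < κ` the
combination `κ Q - γ S₂` is conserved, and `(Q - κ C / ω², γ S₃ / ω)` rotates with angular frequency
`2ω`, so `Q` is at most the centre plus the radius (`stokes_bound`). The solutions are only weakly
differentiable in time; `hasDerivAt_inner_of_weak` supplies the product rule by uniform boundedness
on the complete space `H1`.

At and above the threshold: let `(a, b)` solve the linear `x`-independent system. Then `(a φ, b φ)`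
solves the Manakov system as soon as `i φ_t = -φ_xx - G(t)|φ|²φ` with `G = g (|a|² + |b|²)`, and its
power is `(|a|² + |b|²) ‖φ(0)‖²` because the mass of `φ` is conserved. An unbounded `(a, b)` is
explicit (`exists_growing_linear`), so what remains is global existence for `φ`
(`H1.exists_global_nls`).

That existence is proved in the interaction picture `α(t) = e^{-it∂²} φ(t)`. There the equation
becomes an ordinary differential equation on `H1`, locally Lipschitz because `H1` is an algebra.
Mass conservation, an energy identity and Grönwall's inequality bound `α` on bounded time intervals,
and `exists_global_of_apriori_bound` continues the local solutions. -/

theorem isClosed_sobolevH1 : IsClosed (sobolevH1 : Set (WithLp 2 (L2 × L2))) := by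
  have h1 : Continuous fun p : WithLp 2 (L2 × L2) =>
      TemperedDistribution.derivCLM ℂ (Lp.toTemperedDistribution p.fst) :=
    (TemperedDistribution.derivCLM ℂ).continuous.comp
      ((Lp.toTemperedDistributionCLM ℂ volume 2).continuous.comp
        (WithLp.fstL 2 ℂ L2 L2).continuous)
  have h2 : Continuous fun p : WithLp 2 (L2 × L2) => Lp.toTemperedDistribution p.snd :=
    (Lp.toTemperedDistributionCLM ℂ volume 2).continuous.comp
        (WithLp.sndL 2 ℂ L2 L2).continuous
  exact isClosed_eq h1 h2

instance completeSpaceH1 : CompleteSpace H1 := isClosed_sobolevH1.completeSpace_coe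

namespace H1

/-- The inclusion of `H¹(ℝ)` in `L²(ℝ)`. -/
noncomputable def fnL : H1 →L[ℂ] L2 := (WithLp.fstL 2 ℂ L2 L2).comp sobolevH1.subtypeL

/-- The weak derivative as a continuous linear map. -/
noncomputable def dxL : H1 →L[ℂ] L2 := (WithLp.sndL 2 ℂ L2 L2).comp sobolevH1.subtypeL

@[simp] theorem fn_add (f g : H1) : (f + g).fn = f.fn + g.fn := rfl
@[simp] theorem dx_add (f g : H1) : (f + g).dx = f.dx + g.dx := rfl
@[simp] theorem fn_sub (f g : H1) : (f - g).fn = f.fn - g.fn := rfl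
@[simp] theorem fn_smul (c : ℂ) (f : H1) : (c • f).fn = c • f.fn := rfl
@[simp] theorem dx_smul (c : ℂ) (f : H1) : (c • f).dx = c • f.dx := rfl

theorem ext_fn_dx {f g : H1} (h1 : f.fn = g.fn) (h2 : f.dx = g.dx) : f = g := by
  apply Subtype.ext
  apply (WithLp.equiv 2 (L2 × L2)).injective
  exact Prod.ext h1 h2

theorem norm_sq (f : H1) : ‖f‖ ^ 2 = ‖f.fn‖ ^ 2 + ‖f.dx‖ ^ 2 :=
  WithLp.prod_norm_sq_eq_of_L2 f.val

theorem norm_fn_le (f : H1) : ‖f.fn‖ ≤ ‖f‖ := by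
  have := norm_sq f
  nlinarith [norm_nonneg f, norm_nonneg f.fn, sq_nonneg ‖f.dx‖]

theorem norm_dx_le (f : H1) : ‖f.dx‖ ≤ ‖f‖ := by
  have := norm_sq f
  nlinarith [norm_nonneg f, norm_nonneg f.dx, sq_nonneg ‖f.fn‖]

theorem norm_le_add (f : H1) : ‖f‖ ≤ ‖f.fn‖ + ‖f.dx‖ := by
  have := norm_sq f
  nlinarith [norm_nonneg f, norm_nonneg f.dx, norm_nonneg f.fn]

theorem inner_eq (f g : H1) : inner ℂ f g = inner ℂ f.fn g.fn + inner ℂ f.dx g.dx :=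
  WithLp.prod_inner_apply f.val g.val

end H1

/-! ### Descriptions of `H¹(ℝ)` by Fourier transform and by test functions; density of Schwartz
functions -/

theorem derivCLM_eq_lineDeriv (T : 𝓢'(ℝ, ℂ)) :
    TemperedDistribution.derivCLM ℂ T = LineDeriv.lineDerivOp (1 : ℝ) T := by
  ext g
  rw [TemperedDistribution.derivCLM_apply_apply, TemperedDistribution.lineDerivOp_apply_apply]
  congr 2

open FourierTransform ContDiff in
/-- Membership in `H¹(ℝ)` on the Fourier side. -/
theorem mem_sobolevH1_iff_fourier (p : WithLp 2 (L2 × L2)) :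
    p ∈ sobolevH1 ↔
      ∀ᵐ ξ : ℝ, (𝓕 p.snd : L2) ξ = (2 * Real.pi * Complex.I * ξ) * (𝓕 p.fst : L2) ξ := by
  have key : ∀ g : 𝓢(ℝ, ℂ), 𝓕 (TemperedDistribution.derivCLM ℂ (Lp.toTemperedDistribution p.fst)) g
      = ∫ ξ : ℝ, g ξ * ((2 * Real.pi * Complex.I * ξ) * (𝓕 p.fst : L2) ξ) := by
    intro g
    rw [derivCLM_eq_lineDeriv, TemperedDistribution.fourier_lineDerivOp_eq,
      Lp.fourier_toTemperedDistribution_eq]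
    have hid : (fun x : ℝ => (x : ℂ)).HasTemperateGrowth := by fun_prop
    simp
    rw [← integral_const_mul]
    refine integral_congr_ae (Eventually.of_forall fun x => ?_)
    simp [hid]
    ring
  have key2 : ∀ g : 𝓢(ℝ, ℂ), 𝓕 (Lp.toTemperedDistribution p.snd) g
      = ∫ ξ : ℝ, g ξ * (𝓕 p.snd : L2) ξ := by
    intro g
    rw [Lp.fourier_toTemperedDistribution_eq, Lp.toTemperedDistribution_apply]
    rfl
  change TemperedDistribution.derivCLM ℂ (Lp.toTemperedDistribution p.fst) =
    Lp.toTemperedDistribution p.snd ↔ _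
  constructor
  · intro h
    have l1 : LocallyIntegrable (𝓕 p.snd : L2) := (Lp.memLp _).locallyIntegrable (by norm_num)
    have l2 : LocallyIntegrable
        (fun ξ : ℝ => (2 * Real.pi * Complex.I * ξ) * (𝓕 p.fst : L2) ξ) := by
      have h1 : LocallyIntegrable (𝓕 p.fst : L2) := (Lp.memLp _).locallyIntegrable (by norm_num)
      have hc : Continuous fun ξ : ℝ => 2 * Real.pi * Complex.I * (ξ : ℂ) := by fun_prop
      exact h1.continuous_smul hc
    have hint : LocallyIntegrable
        (fun ξ : ℝ => (𝓕 p.snd : L2) ξ - (2 * Real.pi * Complex.I * ξ) * (𝓕 p.fst : L2) ξ) := by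
      exact l1.sub l2
    -- Equality of the two distributions gives equality almost everywhere once it is tested on
    -- compactly supported smooth functions, which are Schwartz functions.
    have := ae_eq_zero_of_integral_contDiff_smul_eq_zero hint ?_
    · filter_upwards [this] with ξ hξ
      exact sub_eq_zero.mp hξ
    intro g hg hgc
    have hg₁ : HasCompactSupport (Complex.ofRealCLM ∘ g) := hgc.comp_left rfl
    have hg₂ : ContDiff ℝ ∞ (Complex.ofRealCLM ∘ g) := by fun_prop
    have k1 := key (hg₁.toSchwartzMap hg₂)
    have k2 := key2 (hg₁.toSchwartzMap hg₂)
    rw [h, k2] at k1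
    have hgC : Continuous fun x => (g x : ℂ) := Complex.continuous_ofReal.comp hg.continuous
    have i1 := l1.integrable_smul_left_of_hasCompactSupport hgC hg₁
    have i2 := l2.integrable_smul_left_of_hasCompactSupport hgC hg₁
    simp only [HasCompactSupport.toSchwartzMap_toFun, Function.comp_apply,
      Complex.ofRealCLM_apply] at k1
    simp only [smul_eq_mul] at i1 i2
    simp only [Complex.real_smul, mul_sub]
    rw [integral_sub i1 i2, k1, sub_self]
  · intro h
    have : 𝓕 (TemperedDistribution.derivCLM ℂ (Lp.toTemperedDistribution p.fst)) =
        𝓕 (Lp.toTemperedDistribution p.snd) := by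
      ext g
      rw [key, key2]
      refine integral_congr_ae ?_
      filter_upwards [h] with ξ hξ
      rw [hξ]
    have h2 := congrArg (FourierTransformInv.fourierInv (F := 𝓢'(ℝ, ℂ))) this
    rwa [fourierInv_fourier_eq, fourierInv_fourier_eq] at h2

theorem mem_sobolevH1_toLp (f : 𝓢(ℝ, ℂ)) :
    (WithLp.toLp 2 (f.toLp 2, (SchwartzMap.derivCLM ℂ ℂ f).toLp 2) : WithLp 2 (L2 × L2)) ∈
      sobolevH1 := by
  have h : TemperedDistribution.derivCLM ℂ (Lp.toTemperedDistribution (f.toLp 2 (μ := volume))) =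
        Lp.toTemperedDistribution ((SchwartzMap.derivCLM ℂ ℂ f).toLp 2 (μ := volume)) := by
    rw [Lp.toTemperedDistribution_toLp_eq, Lp.toTemperedDistribution_toLp_eq,
        TemperedDistribution.derivCLM_toTemperedDistributionCLM_eq ℂ]
  exact h

/-- A Schwartz function as an element of `H¹(ℝ)`. -/
noncomputable def schwartzH1 (f : 𝓢(ℝ, ℂ)) : H1 := ⟨_, mem_sobolevH1_toLp f⟩

theorem schwartzH1_fn (f : 𝓢(ℝ, ℂ)) : (schwartzH1 f).fn = f.toLp 2 := rfl

theorem schwartzH1_dx (f : 𝓢(ℝ, ℂ)) :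
    (schwartzH1 f).dx = (SchwartzMap.derivCLM ℂ ℂ f).toLp 2 := rfl

theorem schwartzH1_fn_coe (f : 𝓢(ℝ, ℂ)) : (schwartzH1 f).fn =ᵐ[volume] f := f.coeFn_toLp 2 volume

theorem schwartzH1_dx_coe (f : 𝓢(ℝ, ℂ)) : (schwartzH1 f).dx =ᵐ[volume] deriv f := by
  filter_upwards [(SchwartzMap.derivCLM ℂ ℂ f).coeFn_toLp 2 volume] with x hx
  rw [schwartzH1_dx, hx, SchwartzMap.derivCLM_apply]

/-- Membership in `H¹(ℝ)` tested against Schwartz functions. -/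
theorem mem_sobolevH1_iff_integral (p : WithLp 2 (L2 × L2)) :
    p ∈ sobolevH1 ↔ ∀ g : 𝓢(ℝ, ℂ), ∫ x : ℝ, deriv g x * p.fst x = - ∫ x : ℝ, g x * p.snd x := by
  change TemperedDistribution.derivCLM ℂ (Lp.toTemperedDistribution p.fst) =
    Lp.toTemperedDistribution p.snd ↔ _
  have key : ∀ g : 𝓢(ℝ, ℂ), TemperedDistribution.derivCLM ℂ (Lp.toTemperedDistribution p.fst) g
      = - ∫ x : ℝ, deriv g x * p.fst x := by
    intro g
    rw [TemperedDistribution.derivCLM_apply_apply, Lp.toTemperedDistribution_apply, ← integral_neg]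
    refine integral_congr_ae (Eventually.of_forall fun x => ?_)
    simp
  have key2 : ∀ g : 𝓢(ℝ, ℂ), Lp.toTemperedDistribution p.snd g = ∫ x : ℝ, g x * p.snd x :=
    fun g => Lp.toTemperedDistribution_apply _ g
  constructor
  · intro h g
    rw [← key2, ← h, key, neg_neg]
  · intro h
    ext g
    rw [key, key2, h, neg_neg]

/-- Complex conjugation of a Schwartz function. -/
noncomputable def schwartzConj (g : 𝓢(ℝ, ℂ)) : 𝓢(ℝ, ℂ) :=
  g.postcompCLM (𝕜 := ℝ) Complex.conjCLE.toContinuousLinearMap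

theorem schwartzConj_apply (g : 𝓢(ℝ, ℂ)) (x : ℝ) : schwartzConj g x = conj (g x) := rfl

theorem deriv_schwartzConj (g : 𝓢(ℝ, ℂ)) (x : ℝ) :
    deriv (schwartzConj g) x = conj (deriv g x) := by
  have : HasDerivAt (schwartzConj g) (conj (deriv g x)) x := (g.hasDerivAt x).star
  exact this.deriv

theorem inner_L2 (f g : L2) : inner ℂ f g = ∫ x : ℝ, g x * conj (f x) := rfl

namespace H1

theorem integral_deriv_mul (f : H1) (g : 𝓢(ℝ, ℂ)) :
    ∫ x : ℝ, deriv g x * f.fn x = - ∫ x : ℝ, g x * f.dx x :=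
  (mem_sobolevH1_iff_integral f.val).1 f.property g

open FourierTransform in
theorem fourier_dx (f : H1) :
    ∀ᵐ ξ : ℝ, (𝓕 f.dx : L2) ξ = (2 * Real.pi * Complex.I * ξ) * (𝓕 f.fn : L2) ξ :=
  (mem_sobolevH1_iff_fourier f.val).1 f.property

/-- Schwartz functions are dense in `H¹(ℝ)`. -/
theorem denseRange_schwartzH1 : DenseRange schwartzH1 := by
  let D := (SchwartzMap.toLpCLM ℂ ℂ 2 (volume : Measure ℝ)).comp (SchwartzMap.derivCLM ℂ ℂ)
  let L : 𝓢(ℝ, ℂ) →ₗ[ℂ] H1 :=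
    { toFun := schwartzH1
      map_add' := fun f g => ext_fn_dx
        (by rw [fn_add]; exact map_add (SchwartzMap.toLpCLM ℂ ℂ 2 volume) f g)
        (by rw [dx_add]; exact map_add D f g)
      map_smul' := fun c f => ext_fn_dx
        (by rw [RingHom.id_apply, fn_smul]; exact map_smul (SchwartzMap.toLpCLM ℂ ℂ 2 volume) c f)
        (by rw [RingHom.id_apply, dx_smul]; exact map_smul D c f) }
  have hL : L.range.topologicalClosure = ⊤ := by
    rw [Submodule.topologicalClosure_eq_top_iff, Submodule.eq_bot_iff]
    intro f hf
    have h0 : ∀ g : 𝓢(ℝ, ℂ), inner ℂ (schwartzH1 g) f = 0 := fun g =>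
      (Submodule.mem_orthogonal _ _).1 hf _ ⟨g, rfl⟩
    -- Orthogonality to all Schwartz functions says weakly that `f'' = f`, so `f'` lies in `H¹` with
    -- derivative `f`. On the Fourier side this reads `(1 + 4π²ξ²) f̂ = 0`.
    have hmem : (WithLp.toLp 2 (f.dx, f.fn) : WithLp 2 (L2 × L2)) ∈ sobolevH1 := by
      rw [mem_sobolevH1_iff_integral]
      intro g
      have h1 := h0 (schwartzConj g)
      rw [inner_eq, inner_L2, inner_L2, add_comm, add_eq_zero_iff_eq_neg] at h1
      have e1 : ∫ x : ℝ, f.dx x * conj ((schwartzH1 (schwartzConj g)).dx x)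
          = ∫ x : ℝ, deriv g x * f.dx x := by
        refine integral_congr_ae ?_
        filter_upwards [schwartzH1_dx_coe (schwartzConj g)] with x hx
        rw [hx, deriv_schwartzConj, Complex.conj_conj, mul_comm]
      have e2 : ∫ x : ℝ, f.fn x * conj ((schwartzH1 (schwartzConj g)).fn x)
          = ∫ x : ℝ, g x * f.fn x := by
        refine integral_congr_ae ?_
        filter_upwards [schwartzH1_fn_coe (schwartzConj g)] with x hx
        rw [hx, schwartzConj_apply, Complex.conj_conj, mul_comm]
      rw [e1, e2] at h1
      exact h1
    have hF := (mem_sobolevH1_iff_fourier _).1 hmem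
    have hF' := fourier_dx f
    have hz : (FourierTransform.fourier f.fn : L2) = 0 := by
      apply (Lp.eq_zero_iff_ae_eq_zero).2
      filter_upwards [hF, hF'] with ξ h1 h2
      change (FourierTransform.fourier f.fn : L2) ξ = (2 * Real.pi * Complex.I * ξ) *
        (FourierTransform.fourier f.dx : L2) ξ at h1
      rw [h2] at h1
      have h3 : ((1 + 4 * Real.pi ^ 2 * ξ ^ 2 : ℝ) : ℂ) * (FourierTransform.fourier f.fn : L2) ξ = 0 := by
        push_cast
        linear_combination h1 + 4 * Real.pi ^ 2 * ξ ^ 2 * (FourierTransform.fourier f.fn : L2) ξ * Complex.I_sq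
      rcases mul_eq_zero.1 h3 with h4 | h4
      · exfalso
        have : (1 + 4 * Real.pi ^ 2 * ξ ^ 2 : ℝ) = 0 := by exact_mod_cast h4
        nlinarith [mul_nonneg (sq_nonneg Real.pi) (sq_nonneg ξ)]
      · exact h4
    have hz' : f.fn = 0 := by
      rw [← norm_eq_zero, ← Lp.norm_fourier_eq, hz, norm_zero]
    have hd : f.dx = 0 := by
      rw [← norm_eq_zero, ← Lp.norm_fourier_eq, norm_eq_zero]
      apply (Lp.eq_zero_iff_ae_eq_zero).2
      filter_upwards [hF', Lp.eq_zero_iff_ae_eq_zero.1 hz] with ξ h1 h2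
      rw [h1, h2]; simp
    exact ext_fn_dx hz' hd
  have := (Submodule.dense_iff_topologicalClosure_eq_top).2 hL
  exact this

end H1

/-! ### The Sobolev inequality in dimension one -/

/-- Cauchy–Schwarz in `L²(ℝ)`, with absolute values inside the integral. -/
theorem integral_norm_mul_norm_le (f g : L2) :
    Integrable (fun x : ℝ => ‖f x‖ * ‖g x‖) ∧ ∫ x : ℝ, ‖f x‖ * ‖g x‖ ≤ ‖f‖ * ‖g‖ := by
  let F : Lp ℂ 1 (volume : Measure ℝ) := (ContinuousLinearMap.mul ℂ ℂ).holder 1 f g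
  have hF : F =ᵐ[volume] fun x => f x * g x := (ContinuousLinearMap.mul ℂ ℂ).coeFn_holder f g
  have h1 : (fun x => ‖F x‖) =ᵐ[volume] fun x : ℝ => ‖f x‖ * ‖g x‖ := by
    filter_upwards [hF] with x hx
    rw [hx, norm_mul]
  refine ⟨(L1.integrable_coeFn F).norm.congr h1, ?_⟩
  rw [← integral_congr_ae h1, ← L1.norm_eq_integral_norm]
  refine ((ContinuousLinearMap.mul ℂ ℂ).norm_holder_apply_apply_le f g).trans ?_
  have := ContinuousLinearMap.opNorm_mul_le ℂ ℂ
  calc _ ≤ 1 * ‖f‖ * ‖g‖ := by gcongr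
    _ = _ := by ring

/-- The one-dimensional Sobolev inequality for Schwartz functions. -/
theorem SchwartzMap.norm_sq_le (f : 𝓢(ℝ, ℂ)) (x : ℝ) :
    ‖f x‖ ^ 2 ≤ 2 * ‖(schwartzH1 f).fn‖ * ‖(schwartzH1 f).dx‖ := by
  obtain ⟨hi, hle⟩ := integral_norm_mul_norm_le (schwartzH1 f).fn (schwartzH1 f).dx
  have hae : (fun x : ℝ => ‖(schwartzH1 f).fn x‖ * ‖(schwartzH1 f).dx x‖) =ᵐ[volume]
      fun x => ‖f x‖ * ‖deriv f x‖ := by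
    filter_upwards [schwartzH1_fn_coe f, schwartzH1_dx_coe f] with x h1 h2
    rw [h1, h2]
  replace hi := hi.congr hae
  rw [integral_congr_ae hae] at hle
  have hd : ∀ y, HasDerivAt (fun y => f y * conj (f y))
      (deriv f y * conj (f y) + f y * conj (deriv f y)) y :=
    fun y => (f.hasDerivAt y).mul (f.hasDerivAt y).star
  have hcd : Continuous (deriv f) := (SchwartzMap.derivCLM ℂ ℂ f).continuous
  have hb : ∀ y, ‖deriv f y * conj (f y) + f y * conj (deriv f y)‖ ≤ 2 * (‖f y‖ * ‖deriv f y‖) := by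
    intro y
    refine (norm_add_le _ _).trans ?_
    simp only [norm_mul, RCLike.norm_conj]
    linarith [mul_comm ‖deriv f y‖ ‖f y‖]
  have hi2 : Integrable (fun y => deriv f y * conj (f y) + f y * conj (deriv f y)) := by
    refine (hi.const_mul 2).mono' ?_ (Eventually.of_forall hb)
    have := f.continuous
    exact Continuous.aestronglyMeasurable (by fun_prop)
  have ht : Tendsto (fun y => f y * conj (f y)) atBot (𝓝 0) := by
    have h1 : Tendsto f atBot (𝓝 0) := f.tendsto_cocompact.mono_left atBot_le_cocompact
    have := h1.mul ((Complex.continuous_conj.tendsto 0).comp h1)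
    simpa using this
  -- `|f(x)|²` is the integral of `(f f̄)'` over `(-∞, x]`, and `|(f f̄)'| ≤ 2 |f| |f'|`.
  have hI := integral_Iic_of_hasDerivAt_of_tendsto' (a := x) (fun y _ => hd y) hi2.integrableOn ht
  have : ‖f x‖ ^ 2 = ‖f x * conj (f x) - 0‖ := by
    rw [sub_zero, norm_mul, RCLike.norm_conj, sq]
  rw [this, ← hI]
  calc _ ≤ ∫ y in Set.Iic x, 2 * (‖f y‖ * ‖deriv f y‖) :=
        norm_integral_le_of_norm_le (hi.const_mul 2).integrableOn (Eventually.of_forall hb)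
    _ ≤ ∫ y, 2 * (‖f y‖ * ‖deriv f y‖) :=
        setIntegral_le_integral (hi.const_mul 2) (Eventually.of_forall fun y => by positivity)
    _ = 2 * ∫ y, ‖f y‖ * ‖deriv f y‖ := integral_const_mul _ _
    _ ≤ _ := by rw [mul_assoc]; linarith

/-- Both sides pass to the limit from Schwartz functions: the right one by continuity of the norms,
the left one along a subsequence that converges almost everywhere. -/
theorem H1.norm_sq_le_ae (f : H1) : ∀ᵐ x : ℝ, ‖f.fn x‖ ^ 2 ≤ 2 * ‖f.fn‖ * ‖f.dx‖ := by
  obtain ⟨u, hu, hlim⟩ := mem_closure_iff_seq_limit.1 (H1.denseRange_schwartzH1 f)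
  choose s hs using hu
  have hlim1 : Tendsto (fun n => (u n).fn) atTop (𝓝 f.fn) := (H1.fnL.continuous.tendsto f).comp hlim
  have hlim2 : Tendsto (fun n => (u n).dx) atTop (𝓝 f.dx) := (H1.dxL.continuous.tendsto f).comp hlim
  obtain ⟨φ, hφ, hae⟩ := (tendstoInMeasure_of_tendsto_Lp hlim1).exists_seq_tendsto_ae
  have hall : ∀ᵐ x : ℝ, ∀ n, (schwartzH1 (s n)).fn x = s n x :=
    ae_all_iff.2 fun n => schwartzH1_fn_coe (s n)
  filter_upwards [hae, hall] with x hx1 hx2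
  refine le_of_tendsto_of_tendsto (hx1.norm.pow 2)
    (((hlim1.norm.const_mul 2).mul hlim2.norm).comp hφ.tendsto_atTop) (Eventually.of_forall fun n => ?_)
  change ‖(u (φ n)).fn x‖ ^ 2 ≤ 2 * ‖(u (φ n)).fn‖ * ‖(u (φ n)).dx‖
  rw [← hs, hx2]
  exact (s (φ n)).norm_sq_le x

/-! ### The algebra `H¹(ℝ)` and the cubic nonlinearity -/

namespace H1

theorem norm_fn_le_ae (f : H1) : ∀ᵐ x : ℝ, ‖f.fn x‖ ≤ ‖f‖ := by
  filter_upwards [norm_sq_le_ae f] with x hx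
  have := norm_sq f
  have h2 : ‖f.fn x‖ ^ 2 ≤ ‖f‖ ^ 2 := by
    nlinarith [sq_nonneg (‖f.fn‖ - ‖f.dx‖)]
  exact (sq_le_sq₀ (norm_nonneg _) (norm_nonneg _)).1 h2

theorem memLp_top (f : H1) : MemLp f.fn ∞ volume :=
  memLp_top_of_bound (Lp.aestronglyMeasurable _) ‖f‖ (norm_fn_le_ae f)

/-- The Sobolev embedding of `H¹(ℝ)` into `L^∞(ℝ)`. -/
noncomputable def toLinfty : H1 →L[ℂ] Lp ℂ ∞ (volume : Measure ℝ) :=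
  LinearMap.mkContinuous
    { toFun := fun f => (memLp_top f).toLp _
      map_add' := fun f g => by
        rw [← MemLp.toLp_add]
        exact MemLp.toLp_congr _ _ (Lp.coeFn_add f.fn g.fn)
      map_smul' := fun c f => by
        rw [RingHom.id_apply, ← MemLp.toLp_const_smul]
        exact MemLp.toLp_congr _ _ (Lp.coeFn_smul c f.fn) }
    1 (fun f => by
      rw [one_mul]
      change ‖(memLp_top f).toLp _‖ ≤ ‖f‖
      rw [Lp.norm_toLp, eLpNorm_exponent_top]
      exact ENNReal.toReal_le_of_le_ofReal (norm_nonneg f)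
        (eLpNormEssSup_le_of_ae_bound (norm_fn_le_ae f)))

theorem toLinfty_coe (f : H1) : toLinfty f =ᵐ[volume] f.fn := (memLp_top f).coeFn_toLp

theorem norm_toLinfty_le (f : H1) : ‖toLinfty f‖ ≤ ‖f‖ := by
  simpa using (toLinfty.le_of_opNorm_le (LinearMap.mkContinuous_norm_le _ zero_le_one _) f)

/-- Multiplication `L^∞ × L² → L²`. -/
noncomputable def mulLinfty : Lp ℂ ∞ (volume : Measure ℝ) →L[ℂ] L2 →L[ℂ] L2 :=
  (ContinuousLinearMap.mul ℂ ℂ).holderL volume ∞ 2 2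

theorem mulLinfty_coe (f : Lp ℂ ∞ (volume : Measure ℝ)) (g : L2) :
    mulLinfty f g =ᵐ[volume] fun x => f x * g x :=
  (ContinuousLinearMap.mul ℂ ℂ).coeFn_holder f g

theorem mulLinfty_toLinfty_coe (f : H1) (g : L2) :
    mulLinfty (toLinfty f) g =ᵐ[volume] fun x => f.fn x * g x := by
  filter_upwards [mulLinfty_coe (toLinfty f) g, toLinfty_coe f] with x h1 h2
  rw [h1, h2]

theorem norm_mulLinfty_le (f : Lp ℂ ∞ (volume : Measure ℝ)) (g : L2) :
    ‖mulLinfty f g‖ ≤ ‖f‖ * ‖g‖ := by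
  refine ((ContinuousLinearMap.mul ℂ ℂ).norm_holder_apply_apply_le f g).trans ?_
  have := ContinuousLinearMap.opNorm_mul_le ℂ ℂ
  calc _ ≤ 1 * ‖f‖ * ‖g‖ := by gcongr
    _ = _ := by ring

/-- The product of two elements of `H¹(ℝ)` with its weak derivative. -/
noncomputable def mulPair (f g : H1) : WithLp 2 (L2 × L2) :=
  WithLp.toLp 2 (mulLinfty (toLinfty f) g.fn,
    mulLinfty (toLinfty f) g.dx + mulLinfty (toLinfty g) f.dx)

theorem continuous_mulPair : Continuous fun p : H1 × H1 => mulPair p.1 p.2 := by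
  have h1 : Continuous fun p : H1 × H1 => mulLinfty (toLinfty p.1) p.2.fn :=
    (mulLinfty.continuous.comp (toLinfty.continuous.comp continuous_fst)).clm_apply
      (fnL.continuous.comp continuous_snd)
  have h2 : Continuous fun p : H1 × H1 => mulLinfty (toLinfty p.1) p.2.dx :=
    (mulLinfty.continuous.comp (toLinfty.continuous.comp continuous_fst)).clm_apply
      (dxL.continuous.comp continuous_snd)
  have h3 : Continuous fun p : H1 × H1 => mulLinfty (toLinfty p.2) p.1.dx :=
    (mulLinfty.continuous.comp (toLinfty.continuous.comp continuous_snd)).clm_apply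
      (dxL.continuous.comp continuous_fst)
  exact (WithLp.prod_continuous_toLp 2 L2 L2).comp (h1.prodMk (h2.add h3))

/-- The Leibniz rule in `H¹(ℝ)`. -/
theorem mulPair_mem (f g : H1) : mulPair f g ∈ sobolevH1 := by
  -- Membership of `mulPair f g` is a closed condition on `(f, g)`, so the classical product rule
  -- for Schwartz functions suffices.
  refine denseRange_schwartzH1.induction_on₂ (p := fun f g => mulPair f g ∈ sobolevH1)
    (isClosed_sobolevH1.preimage continuous_mulPair) (fun a b => ?_) f g
  let c : 𝓢(ℝ, ℂ) := SchwartzMap.pairing (ContinuousLinearMap.mul ℂ ℂ) a b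
  have hc : ∀ x, c x = a x * b x := fun x => rfl
  have : mulPair (schwartzH1 a) (schwartzH1 b) = (schwartzH1 c).val := by
    apply (WithLp.equiv 2 (L2 × L2)).injective
    refine Prod.ext ?_ ?_
    · apply Lp.ext
      filter_upwards [mulLinfty_toLinfty_coe (schwartzH1 a) (schwartzH1 b).fn,
        schwartzH1_fn_coe a, schwartzH1_fn_coe b, schwartzH1_fn_coe c] with x h1 h2 h3 h4
      exact h1.trans (by rw [h2, h3]; exact h4.symm)
    · apply Lp.ext
      filter_upwards [mulLinfty_toLinfty_coe (schwartzH1 a) (schwartzH1 b).dx,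
        mulLinfty_toLinfty_coe (schwartzH1 b) (schwartzH1 a).dx,
        Lp.coeFn_add (mulLinfty (toLinfty (schwartzH1 a)) (schwartzH1 b).dx)
          (mulLinfty (toLinfty (schwartzH1 b)) (schwartzH1 a).dx),
        schwartzH1_fn_coe a, schwartzH1_fn_coe b, schwartzH1_dx_coe a, schwartzH1_dx_coe b,
        schwartzH1_dx_coe c] with x h1 h1' h1'' h2 h3 h4 h5 h6
      refine h1''.trans ?_
      rw [Pi.add_apply, h1, h1', h2, h3, h4, h5]
      refine Eq.trans ?_ h6.symm
      have : HasDerivAt c (deriv a x * b x + a x * deriv b x) x :=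
        (a.hasDerivAt x).mul (b.hasDerivAt x)
      rw [this.deriv]; ring
  rw [this]
  exact (schwartzH1 c).property

/-- The pointwise product on `H¹(ℝ)`. -/
noncomputable def mul (f g : H1) : H1 := ⟨mulPair f g, mulPair_mem f g⟩

theorem mul_fn (f g : H1) : (mul f g).fn = mulLinfty (toLinfty f) g.fn := rfl

theorem mul_dx (f g : H1) :
    (mul f g).dx = mulLinfty (toLinfty f) g.dx + mulLinfty (toLinfty g) f.dx := rfl

theorem mul_fn_coe (f g : H1) : (mul f g).fn =ᵐ[volume] fun x => f.fn x * g.fn x :=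
  mulLinfty_toLinfty_coe f g.fn

theorem norm_mul_le (f g : H1) : ‖mul f g‖ ≤ 3 * ‖f‖ * ‖g‖ := by
  have h1 : ‖(mul f g).fn‖ ≤ ‖f‖ * ‖g‖ := by
    rw [mul_fn]
    exact (norm_mulLinfty_le _ _).trans
      (mul_le_mul (norm_toLinfty_le f) (norm_fn_le g) (norm_nonneg _) (norm_nonneg _))
  have h2 : ‖(mul f g).dx‖ ≤ ‖f‖ * ‖g‖ + ‖g‖ * ‖f‖ := by
    rw [mul_dx]
    exact (norm_add_le _ _).trans (add_le_add
      ((norm_mulLinfty_le _ _).trans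
        (mul_le_mul (norm_toLinfty_le f) (norm_dx_le g) (norm_nonneg _) (norm_nonneg _)))
      ((norm_mulLinfty_le _ _).trans
        (mul_le_mul (norm_toLinfty_le g) (norm_dx_le f) (norm_nonneg _) (norm_nonneg _))))
  have := norm_le_add (mul f g)
  linarith

theorem continuous_mul : Continuous fun p : H1 × H1 => mul p.1 p.2 :=
  continuous_mulPair.subtype_mk _

/-- The Fourier transform of the derivative is determined by that of the function. Identities in
`H1` can hence be checked on values alone, without computing any derivative. -/
theorem ext_ae {f g : H1} (h : f.fn =ᵐ[volume] g.fn) : f = g := by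
  have h1 : f.fn = g.fn := Lp.ext h
  refine ext_fn_dx h1 ?_
  apply (Lp.fourierTransformₗᵢ ℝ ℂ).injective
  apply Lp.ext
  filter_upwards [fourier_dx f, fourier_dx g] with ξ h2 h3
  exact h2.trans (Eq.trans (by rw [h1]) h3.symm)

/-- `H¹(ℝ)` is stable under complex conjugation. -/
theorem conj_mem (f : H1) :
    (WithLp.toLp 2 (star f.fn, star f.dx) : WithLp 2 (L2 × L2)) ∈ sobolevH1 := by
  rw [mem_sobolevH1_iff_integral]
  intro g
  have h := congrArg conj (integral_deriv_mul f (schwartzConj g))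
  rw [map_neg, ← integral_conj, ← integral_conj] at h
  calc ∫ x : ℝ, deriv g x * (star f.fn : L2) x
      = ∫ x : ℝ, conj (deriv (schwartzConj g) x * f.fn x) := by
        refine integral_congr_ae ?_
        filter_upwards [Lp.coeFn_star f.fn] with x hx
        rw [hx, deriv_schwartzConj, map_mul, Complex.conj_conj]; rfl
    _ = _ := h
    _ = - ∫ x : ℝ, g x * (star f.dx : L2) x := by
        congr 1
        refine integral_congr_ae ?_
        filter_upwards [Lp.coeFn_star f.dx] with x hx
        rw [hx, schwartzConj_apply, map_mul, Complex.conj_conj]; rfl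

/-- Complex conjugation on `H¹(ℝ)`. -/
noncomputable def conjH (f : H1) : H1 := ⟨_, conj_mem f⟩

theorem conjH_fn_coe (f : H1) : (conjH f).fn =ᵐ[volume] fun x => conj (f.fn x) :=
  Lp.coeFn_star f.fn

theorem conjH_dx_coe (f : H1) : (conjH f).dx =ᵐ[volume] fun x => conj (f.dx x) :=
  Lp.coeFn_star f.dx

theorem norm_conjH (f : H1) : ‖conjH f‖ = ‖f‖ := by
  have h1 : ‖(conjH f).fn‖ = ‖f.fn‖ := by
    rw [Lp.norm_def, Lp.norm_def]
    congr 1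
    refine eLpNorm_congr_norm_ae ?_
    filter_upwards [conjH_fn_coe f] with x hx
    rw [hx, RCLike.norm_conj]
  have h2 : ‖(conjH f).dx‖ = ‖f.dx‖ := by
    rw [Lp.norm_def, Lp.norm_def]
    congr 1
    refine eLpNorm_congr_norm_ae ?_
    filter_upwards [conjH_dx_coe f] with x hx
    rw [hx, RCLike.norm_conj]
  have : ‖conjH f‖ ^ 2 = ‖f‖ ^ 2 := by rw [norm_sq, norm_sq, h1, h2]
  exact (sq_eq_sq₀ (norm_nonneg _) (norm_nonneg _)).1 this

theorem conjH_sub (f g : H1) : conjH (f - g) = conjH f - conjH g := by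
  apply ext_ae
  rw [fn_sub]
  filter_upwards [conjH_fn_coe (f - g), conjH_fn_coe f, conjH_fn_coe g,
    Lp.coeFn_sub (conjH f).fn (conjH g).fn, Lp.coeFn_sub f.fn g.fn] with x h1 h2 h3 h4 h5
  rw [h1, h4, Pi.sub_apply, h2, h3, fn_sub, h5, Pi.sub_apply, map_sub]

attribute [irreducible] mul conjH

theorem continuous_conjH : Continuous conjH := by
  refine (LipschitzWith.of_dist_le_mul (K := 1) fun f g => ?_).continuous
  rw [dist_eq_norm, dist_eq_norm, ← conjH_sub, norm_conjH]; simp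

/-- The trilinear form `f ḡ h`. -/
noncomputable def tri (f g h : H1) : H1 := mul (mul f (conjH g)) h

theorem tri_fn_coe (f g h : H1) :
    (tri f g h).fn =ᵐ[volume] fun x => f.fn x * conj (g.fn x) * h.fn x := by
  filter_upwards [mul_fn_coe (mul f (conjH g)) h, mul_fn_coe f (conjH g), conjH_fn_coe g]
    with x h1 h2 h3
  rw [tri, h1, h2, h3]

theorem norm_tri_le (f g h : H1) : ‖tri f g h‖ ≤ 9 * ‖f‖ * ‖g‖ * ‖h‖ := by
  refine (norm_mul_le _ _).trans ?_
  have := norm_mul_le f (conjH g)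
  rw [norm_conjH] at this
  calc 3 * ‖mul f (conjH g)‖ * ‖h‖ ≤ 3 * (3 * ‖f‖ * ‖g‖) * ‖h‖ := by gcongr
    _ = _ := by ring

theorem continuous_tri : Continuous fun p : H1 × H1 × H1 => tri p.1 p.2.1 p.2.2 := by
  have h0 : Continuous fun p : H1 × H1 × H1 => conjH p.2.1 :=
    continuous_conjH.comp (continuous_fst.comp continuous_snd)
  have h1 : Continuous fun p : H1 × H1 × H1 => mul p.1 (conjH p.2.1) :=
    continuous_mul.comp (continuous_fst.prodMk h0)
  exact continuous_mul.comp (h1.prodMk (continuous_snd.comp continuous_snd))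

attribute [irreducible] tri

/-- The cubic nonlinearity `|f|² f`. -/
noncomputable def cubic (f : H1) : H1 := tri f f f

theorem cubic_fn_coe (f : H1) :
    (cubic f).fn =ᵐ[volume] fun x => (‖f.fn x‖ ^ 2 : ℝ) * f.fn x := by
  filter_upwards [tri_fn_coe f f f] with x h1
  rw [cubic, h1, Complex.mul_conj, Complex.normSq_eq_norm_sq]

theorem continuous_cubic : Continuous cubic :=
  continuous_tri.comp (continuous_id.prodMk (continuous_id.prodMk continuous_id))

/-- Telescoping gives three terms with one factor `f - g` each; every term costs the constant 9 of
`norm_tri_le`. -/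
theorem norm_cubic_sub_le {R : ℝ} {f g : H1} (hf : ‖f‖ ≤ R) (hg : ‖g‖ ≤ R) :
    ‖cubic f - cubic g‖ ≤ 27 * R ^ 2 * ‖f - g‖ := by
  have hR : 0 ≤ R := (norm_nonneg f).trans hf
  have key : cubic f - cubic g = tri (f - g) f f + tri g (f - g) f + tri g g (f - g) := by
    apply ext_ae
    simp only [fn_add, fn_sub]
    filter_upwards [Lp.coeFn_sub (cubic f).fn (cubic g).fn,
      Lp.coeFn_add ((tri (f - g) f f).fn + (tri g (f - g) f).fn) (tri g g (f - g)).fn,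
      Lp.coeFn_add (tri (f - g) f f).fn (tri g (f - g) f).fn, tri_fn_coe f f f, tri_fn_coe g g g,
      tri_fn_coe (f - g) f f, tri_fn_coe g (f - g) f, tri_fn_coe g g (f - g),
      Lp.coeFn_sub f.fn g.fn] with x h1 h2 h3 h4 h5 h6 h7 h8 h9
    rw [h1, h2, Pi.add_apply, h3, Pi.add_apply, Pi.sub_apply, cubic, cubic, h4, h5, h6, h7, h8,
      fn_sub, h9, Pi.sub_apply, map_sub]
    ring
  rw [key]
  have e1 := norm_tri_le (f - g) f f
  have e2 := norm_tri_le g (f - g) f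
  have e3 := norm_tri_le g g (f - g)
  have n := norm_nonneg (f - g)
  have b1 : 9 * ‖f - g‖ * ‖f‖ * ‖f‖ ≤ 9 * ‖f - g‖ * R * R := by gcongr
  have b2 : 9 * ‖g‖ * ‖f - g‖ * ‖f‖ ≤ 9 * R * ‖f - g‖ * R := by gcongr
  have b3 : 9 * ‖g‖ * ‖g‖ * ‖f - g‖ ≤ 9 * R * R * ‖f - g‖ := by gcongr
  calc _ ≤ ‖tri (f - g) f f‖ + ‖tri g (f - g) f‖ + ‖tri g g (f - g)‖ := norm_add₃_le
    _ ≤ 27 * R ^ 2 * ‖f - g‖ := by linarith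

end H1

/-! ### The free Schrödinger group -/

open FourierTransform

/-- The Fourier multiplier `e^{-4π²iξ²t}` of the free Schrödinger group. -/
noncomputable def freePhase (t ξ : ℝ) : ℂ :=
  Complex.exp (((-(4 * Real.pi ^ 2 * ξ ^ 2 * t) : ℝ) : ℂ) * Complex.I)

theorem norm_freePhase (t ξ : ℝ) : ‖freePhase t ξ‖ = 1 := Complex.norm_exp_ofReal_mul_I _

theorem freePhase_add (s t ξ : ℝ) : freePhase (s + t) ξ = freePhase s ξ * freePhase t ξ := by
  rw [freePhase, freePhase, freePhase, ← Complex.exp_add]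
  congr 1
  push_cast
  ring

theorem freePhase_zero (ξ : ℝ) : freePhase 0 ξ = 1 := by simp [freePhase]

theorem continuous_freePhase : Continuous fun p : ℝ × ℝ => freePhase p.1 p.2 := by
  unfold freePhase
  fun_prop

theorem memLp_freePhase (t : ℝ) : MemLp (freePhase t) ∞ (volume : Measure ℝ) :=
  memLp_top_of_bound (continuous_freePhase.comp (Continuous.prodMk_right t)).aestronglyMeasurable 1
    (Eventually.of_forall fun ξ => (norm_freePhase t ξ).le)

/-- The free Schrödinger group on `L²(ℝ)`. -/
noncomputable def freeL2 (t : ℝ) : L2 →ₗ[ℂ] L2 :=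
  (Lp.fourierTransformₗᵢ ℝ ℂ).symm.toLinearEquiv.toLinearMap ∘ₗ
    (H1.mulLinfty ((memLp_freePhase t).toLp _)).toLinearMap ∘ₗ
    (Lp.fourierTransformₗᵢ ℝ ℂ).toLinearEquiv.toLinearMap

theorem fourier_freeL2 (t : ℝ) (f : L2) :
    (𝓕 (freeL2 t f) : L2) =ᵐ[volume] fun ξ => freePhase t ξ * (𝓕 f : L2) ξ := by
  have h : (𝓕 (freeL2 t f) : L2) = H1.mulLinfty ((memLp_freePhase t).toLp _) (𝓕 f : L2) :=
    (Lp.fourierTransformₗᵢ ℝ ℂ).apply_symm_apply _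
  rw [h]
  filter_upwards [H1.mulLinfty_coe ((memLp_freePhase t).toLp _) (𝓕 f : L2),
    (memLp_freePhase t).coeFn_toLp] with ξ h1 h2
  rw [h1, h2]

theorem fourier_L2_injective {f g : L2} (h : (𝓕 f : L2) =ᵐ[volume] (𝓕 g : L2)) : f = g :=
  (Lp.fourierTransformₗᵢ ℝ ℂ).injective (Lp.ext h)

theorem norm_freeL2 (t : ℝ) (f : L2) : ‖freeL2 t f‖ = ‖f‖ := by
  rw [← Lp.norm_fourier_eq, ← Lp.norm_fourier_eq f, Lp.norm_def, Lp.norm_def]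
  congr 1
  refine eLpNorm_congr_norm_ae ?_
  filter_upwards [fourier_freeL2 t f] with ξ h
  rw [h, norm_mul, norm_freePhase, one_mul]

theorem freeL2_add (s t : ℝ) (f : L2) : freeL2 s (freeL2 t f) = freeL2 (s + t) f := by
  apply fourier_L2_injective
  filter_upwards [fourier_freeL2 s (freeL2 t f), fourier_freeL2 t f, fourier_freeL2 (s + t) f]
    with ξ h1 h2 h3
  rw [h1, h2, h3, freePhase_add, mul_assoc]

theorem freeL2_zero (f : L2) : freeL2 0 f = f := by
  apply fourier_L2_injective
  filter_upwards [fourier_freeL2 0 f] with ξ h1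
  rw [h1, freePhase_zero, one_mul]

theorem inner_freeL2 (t : ℝ) (f g : L2) :
    inner ℂ g (freeL2 t f) = ∫ ξ : ℝ, freePhase t ξ * ((𝓕 f : L2) ξ * conj ((𝓕 g : L2) ξ)) := by
  rw [← Lp.inner_fourier_eq, inner_L2]
  refine integral_congr_ae ?_
  filter_upwards [fourier_freeL2 t f] with ξ h
  rw [h, mul_assoc]

theorem integrable_mul_conj (f g : L2) : Integrable fun x : ℝ => f x * conj (g x) :=
  L2.integrable_inner (𝕜 := ℂ) g f

theorem continuous_inner_freeL2 (f g : L2) : Continuous fun t => inner ℂ g (freeL2 t f) := by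
  simp only [inner_freeL2]
  have hi := integrable_mul_conj (𝓕 f : L2) (𝓕 g : L2)
  refine continuous_of_dominated (bound := fun ξ => ‖(𝓕 f : L2) ξ * conj ((𝓕 g : L2) ξ)‖)
    (fun t => ?_) (fun t => ?_) hi.norm (Eventually.of_forall fun ξ => ?_)
  · exact ((continuous_freePhase.comp (Continuous.prodMk_right t)).aestronglyMeasurable).mul
      hi.aestronglyMeasurable
  · exact Eventually.of_forall fun ξ => by rw [norm_mul, norm_freePhase, one_mul]
  · exact (continuous_freePhase.comp (Continuous.prodMk_left ξ)).mul continuous_const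

/-- The norms do not depend on time, so the weak continuity of `continuous_inner_freeL2` upgrades to
strong continuity by expanding `‖freeL2 s f - freeL2 t f‖²`. -/
theorem continuous_freeL2 (f : L2) : Continuous fun t => freeL2 t f := by
  rw [continuous_iff_continuousAt]
  intro t
  rw [ContinuousAt, tendsto_iff_norm_sub_tendsto_zero]
  have h : ∀ s, ‖freeL2 s f - freeL2 t f‖ ^ 2
      = 2 * ‖f‖ ^ 2 - 2 * (inner ℂ (freeL2 t f) (freeL2 s f)).re := by
    intro s
    rw [@norm_sub_sq ℂ, norm_freeL2, norm_freeL2, inner_re_symm]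
    simp only [RCLike.re_to_complex]
    ring
  have hc : Tendsto (fun s => ‖freeL2 s f - freeL2 t f‖ ^ 2) (𝓝 t) (𝓝 0) := by
    simp only [h]
    have h1 : Continuous fun s => 2 * ‖f‖ ^ 2 - 2 * (inner ℂ (freeL2 t f) (freeL2 s f)).re :=
      continuous_const.sub (continuous_const.mul
        (Complex.continuous_re.comp (continuous_inner_freeL2 f (freeL2 t f))))
    have h2 := h1.tendsto t
    have e : (inner ℂ (freeL2 t f) (freeL2 t f)).re = ‖f‖ ^ 2 := by
      rw [← norm_freeL2 t f]
      exact inner_self_eq_norm_sq (𝕜 := ℂ) _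
    rwa [e, sub_self] at h2
  have := hc.sqrt
  simpa using this

namespace H1

/-- The group and the derivative are both Fourier multipliers, hence commute. -/
theorem free_mem (t : ℝ) (f : H1) :
    (WithLp.toLp 2 (freeL2 t f.fn, freeL2 t f.dx) : WithLp 2 (L2 × L2)) ∈ sobolevH1 := by
  rw [mem_sobolevH1_iff_fourier]
  filter_upwards [fourier_freeL2 t f.fn, fourier_freeL2 t f.dx, fourier_dx f] with ξ h1 h2 h3
  change (𝓕 (freeL2 t f.dx) : L2) ξ = _ * (𝓕 (freeL2 t f.fn) : L2) ξ
  rw [h1, h2, h3]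
  ring

/-- The free Schrödinger group on `H¹(ℝ)`. -/
noncomputable def free (t : ℝ) : H1 →ₗᵢ[ℂ] H1 where
  toFun f := ⟨_, free_mem t f⟩
  map_add' f g := ext_fn_dx (map_add (freeL2 t) f.fn g.fn) (map_add (freeL2 t) f.dx g.dx)
  map_smul' c f := ext_fn_dx (map_smul (freeL2 t) c f.fn) (map_smul (freeL2 t) c f.dx)
  norm_map' f := by
    refine (sq_eq_sq₀ (norm_nonneg _) (norm_nonneg _)).1 ?_
    rw [norm_sq, norm_sq, ← norm_freeL2 t f.fn, ← norm_freeL2 t f.dx]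
    rfl

theorem free_fn (t : ℝ) (f : H1) : (free t f).fn = freeL2 t f.fn := rfl
theorem free_dx (t : ℝ) (f : H1) : (free t f).dx = freeL2 t f.dx := rfl

theorem free_free (s t : ℝ) (f : H1) : free s (free t f) = free (s + t) f :=
  ext_fn_dx (freeL2_add s t f.fn) (freeL2_add s t f.dx)

theorem free_zero (f : H1) : free 0 f = f := ext_fn_dx (freeL2_zero f.fn) (freeL2_zero f.dx)

theorem free_free_neg (t : ℝ) (f : H1) : free t (free (-t) f) = f := by
  rw [free_free, add_neg_cancel, free_zero]

theorem continuous_free_apply (f : H1) : Continuous fun t => free t f := by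
  refine Continuous.subtype_mk ?_ _
  exact (WithLp.prod_continuous_toLp 2 L2 L2).comp
    ((continuous_freeL2 f.fn).prodMk (continuous_freeL2 f.dx))

theorem continuous_free : Continuous fun p : ℝ × H1 => free p.1 p.2 := by
  rw [continuous_iff_continuousAt]
  rintro ⟨t, f⟩
  rw [ContinuousAt, tendsto_iff_norm_sub_tendsto_zero]
  have hb : ∀ p : ℝ × H1, ‖free p.1 p.2 - free t f‖ ≤ ‖p.2 - f‖ + ‖free p.1 f - free t f‖ := by
    intro p
    have : free p.1 p.2 - free t f = free p.1 (p.2 - f) + (free p.1 f - free t f) := by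
      rw [map_sub]; abel
    rw [this, ← (free p.1).norm_map (p.2 - f)]
    exact norm_add_le _ _
  refine squeeze_zero (fun _ => norm_nonneg _) hb ?_
  have hc : Continuous fun p : ℝ × H1 => ‖p.2 - f‖ + ‖free p.1 f - free t f‖ :=
    ((continuous_snd.sub continuous_const).norm).add
      (((continuous_free_apply f).comp continuous_fst).sub continuous_const).norm
  simpa using hc.tendsto (t, f)

attribute [irreducible] free

/-- The free Schrödinger evolution solves the free equation weakly. -/
theorem hasDerivAt_inner_free (f w : H1) (t : ℝ) :
    HasDerivAt (fun s => inner ℂ w.fn (free s f).fn)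
      (-Complex.I * inner ℂ w.dx (free t f).dx) t := by
  simp only [free_fn, free_dx, inner_freeL2]
  have hi := integrable_mul_conj (𝓕 f.fn : L2) (𝓕 w.fn : L2)
  have hi' := integrable_mul_conj (𝓕 f.dx : L2) (𝓕 w.dx : L2)
  -- The factor `4π²ξ²` produced by the time derivative is shared between `f'` and `w'`. The result
  -- is integrable for `f` and `w` merely in `H¹`, and it is the dominating function below.
  have hae : (fun ξ : ℝ => (𝓕 f.dx : L2) ξ * conj ((𝓕 w.dx : L2) ξ)) =ᵐ[volume]
      fun ξ => ((4 * Real.pi ^ 2 * ξ ^ 2 : ℝ) : ℂ) * ((𝓕 f.fn : L2) ξ * conj ((𝓕 w.fn : L2) ξ)) := by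
    filter_upwards [fourier_dx f, fourier_dx w] with ξ h1 h2
    rw [h1, h2]
    simp only [map_mul, Complex.conj_I, Complex.conj_ofReal, map_ofNat]
    push_cast
    linear_combination (-4 * Real.pi ^ 2 * ξ ^ 2 * (𝓕 f.fn : L2) ξ * conj ((𝓕 w.fn : L2) ξ)) *
      Complex.I_sq
  have hm : ∀ s, AEStronglyMeasurable (freePhase s) (volume : Measure ℝ) := fun s =>
    (continuous_freePhase.comp (Continuous.prodMk_right s)).aestronglyMeasurable
  have hd := (hasDerivAt_integral_of_dominated_loc_of_deriv_le (μ := (volume : Measure ℝ))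
    (F := fun s ξ => freePhase s ξ * ((𝓕 f.fn : L2) ξ * conj ((𝓕 w.fn : L2) ξ)))
    (F' := fun s ξ => -Complex.I * (freePhase s ξ * (((4 * Real.pi ^ 2 * ξ ^ 2 : ℝ) : ℂ) *
      ((𝓕 f.fn : L2) ξ * conj ((𝓕 w.fn : L2) ξ)))))
    (x₀ := t) (s := Set.univ)
    (bound := fun ξ => ‖((4 * Real.pi ^ 2 * ξ ^ 2 : ℝ) : ℂ) *
      ((𝓕 f.fn : L2) ξ * conj ((𝓕 w.fn : L2) ξ))‖) Filter.univ_mem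
    (Eventually.of_forall fun s => (hm s).mul hi.aestronglyMeasurable)
    (hi.bdd_mul (hm t) (c := 1) (Eventually.of_forall fun ξ => (norm_freePhase t ξ).le))
    (((hm t).mul (hi'.congr hae).aestronglyMeasurable).const_mul _)
    (Eventually.of_forall fun ξ s _ => by
      rw [norm_mul, norm_mul (freePhase s ξ), norm_freePhase, norm_neg, Complex.norm_I,
        one_mul, one_mul])
    (hi'.congr hae).norm
    (Eventually.of_forall fun ξ s _ => by
      have h1 : HasDerivAt (fun s : ℝ => ((-(4 * Real.pi ^ 2 * ξ ^ 2 * s) : ℝ) : ℂ) * Complex.I)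
          (((-(4 * Real.pi ^ 2 * ξ ^ 2 * 1) : ℝ) : ℂ) * Complex.I) s :=
        ((((hasDerivAt_id s).const_mul _).neg).ofReal_comp).mul_const _
      have h2 := (h1.cexp).mul_const ((𝓕 f.fn : L2) ξ * conj ((𝓕 w.fn : L2) ξ))
      refine h2.congr_deriv ?_
      rw [freePhase]
      push_cast
      ring)).2
  refine hd.congr_deriv ?_
  rw [integral_const_mul]
  congr 1
  refine integral_congr_ae ?_
  filter_upwards [hae] with ξ h
  rw [h]

end H1

/-! ### Weakly differentiable curves in `H¹(ℝ)` -/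

/-- If all difference quotients of `u` at `t` converge when tested against a fixed `w`, they
converge when tested against `W s → W t`, by the uniform boundedness principle. -/
theorem tendsto_inner_slope {u W : ℝ → H1} {ℓ : H1 → ℂ} {t : ℝ} (hW : ContinuousAt W t)
    (hu : ∀ w : H1, HasDerivAt (fun s => inner ℂ w.fn (u s).fn) (ℓ w) t) :
    Tendsto (fun s => (s - t)⁻¹ • inner ℂ (W s).fn ((u s).fn - (u t).fn)) (𝓝[≠] t)
      (𝓝 (ℓ (W t))) := by
  have hpt : ∀ w : H1, Tendsto (fun s => (s - t)⁻¹ • inner ℂ w.fn ((u s).fn - (u t).fn))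
      (𝓝[≠] t) (𝓝 (ℓ w)) := by
    intro w
    have := hasDerivAt_iff_tendsto_slope.1 (hu w)
    refine this.congr fun s => ?_
    rw [slope_def_module, inner_sub_right]
  -- Along a sequence, convergence for each `w` bounds all difference quotients, as Banach–Steinhaus
  -- requires; along the filter the bound would hold only eventually, depending on `w`.
  refine tendsto_of_seq_tendsto fun x hx => ?_
  let d : ℕ → L2 := fun n => (((x n - t)⁻¹ : ℝ) : ℂ) • ((u (x n)).fn - (u t).fn)
  have hd : ∀ (w : H1) (n : ℕ), inner ℂ w.fn (d n)
      = (x n - t)⁻¹ • inner ℂ w.fn ((u (x n)).fn - (u t).fn) := by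
    intro w n
    rw [inner_smul_right, Complex.real_smul]
  -- The inner product is linear in its second slot, so the quotient goes into the first one; this
  -- only conjugates the value.
  let g : ℕ → H1 →L[ℂ] ℂ := fun n => (innerSL ℂ (d n)).comp H1.fnL
  have hg : ∀ n w, ‖g n w‖ = ‖inner ℂ w.fn (d n)‖ := by
    intro n w
    change ‖inner ℂ (d n) w.fn‖ = _
    rw [← inner_conj_symm, RCLike.norm_conj]
  have hlim : ∀ w : H1, Tendsto (fun n => inner ℂ w.fn (d n)) atTop (𝓝 (ℓ w)) := by
    intro w
    simp only [hd]
    exact (hpt w).comp hx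
  obtain ⟨C, hC⟩ := banach_steinhaus (g := g) fun w => by
    obtain ⟨C, hC⟩ := (hlim w).norm.bddAbove_range
    exact ⟨C, fun n => by rw [hg]; exact hC ⟨n, rfl⟩⟩
  have hWx : Tendsto (fun n => ‖W (x n) - W t‖) atTop (𝓝 0) :=
    tendsto_iff_norm_sub_tendsto_zero.1
      (hW.tendsto.comp (hx.mono_right nhdsWithin_le_nhds))
  have hz : Tendsto (fun n => inner ℂ (W (x n) - W t).fn (d n)) atTop (𝓝 0) := by
    refine squeeze_zero_norm (fun n => ?_) (by simpa using hWx.const_mul C)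
    rw [← hg]
    exact ((g n).le_opNorm _).trans (mul_le_mul_of_nonneg_right (hC n) (norm_nonneg _))
  have := hz.add (hlim (W t))
  rw [zero_add] at this
  refine this.congr fun n => ?_
  change _ = (x n - t)⁻¹ • inner ℂ (W (x n)).fn ((u (x n)).fn - (u t).fn)
  rw [← hd, ← inner_add_left, H1.fn_sub, sub_add_cancel]

/-- The product rule for the inner product of two weakly differentiable curves. -/
theorem hasDerivAt_inner_of_weak {u v : ℝ → H1} {ℓu ℓv : H1 → ℂ} {t : ℝ} (hv : ContinuousAt v t)
    (hu' : ∀ w : H1, HasDerivAt (fun s => inner ℂ w.fn (u s).fn) (ℓu w) t)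
    (hv' : ∀ w : H1, HasDerivAt (fun s => inner ℂ w.fn (v s).fn) (ℓv w) t) :
    HasDerivAt (fun s => inner ℂ (v s).fn (u s).fn) (ℓu (v t) + conj (ℓv (u t))) t := by
  rw [hasDerivAt_iff_tendsto_slope]
  have h1 := tendsto_inner_slope hv hu'
  have h2 := hasDerivAt_iff_tendsto_slope.1 (hv' (u t))
  -- `⟨v(s), u(s)⟩ - ⟨v(t), u(t)⟩` is `⟨v(s), u(s) - u(t)⟩ + ⟨v(s) - v(t), u(t)⟩`; only the first
  -- term has a moving test function.
  refine (h1.add ((Complex.continuous_conj.tendsto _).comp h2)).congr fun s => ?_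
  simp only [slope_def_module, Function.comp_apply, Complex.real_smul, map_mul, map_sub,
    Complex.conj_ofReal, inner_conj_symm, inner_sub_right]
  ring

/-! ### The Stokes variables -/

theorem integral_norm_sq (f : L2) : ∫ x : ℝ, ‖f x‖ ^ 2 = ‖f‖ ^ 2 := by
  have h : inner ℂ f f = ((∫ x : ℝ, ‖f x‖ ^ 2 : ℝ) : ℂ) := by
    rw [inner_L2, ← integral_complex_ofReal]
    refine integral_congr_ae (Eventually.of_forall fun x => ?_)
    simp only [Complex.mul_conj, Complex.normSq_eq_norm_sq]
  have h2 : (inner ℂ f f).re = ‖f‖ ^ 2 := inner_self_eq_norm_sq (𝕜 := ℂ) f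
  rwa [h, Complex.ofReal_re] at h2

theorem integrable_norm_sq (f : L2) : Integrable fun x : ℝ => ‖f x‖ ^ 2 := by
  have := (integral_norm_mul_norm_le f f).1
  simpa only [sq] using this

theorem stokes3_eq (u v : H1) : stokes3 u v = ‖u.fn‖ ^ 2 - ‖v.fn‖ ^ 2 := by
  rw [stokes3, integral_sub (integrable_norm_sq _) (integrable_norm_sq _), integral_norm_sq,
    integral_norm_sq]

theorem stokes2_eq (u v : H1) : stokes2 u v = 2 * (inner ℂ v.fn u.fn).im := by
  have h : ∫ x : ℝ, (conj (u.fn x) * v.fn x - u.fn x * conj (v.fn x))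
      = conj (inner ℂ v.fn u.fn) - inner ℂ v.fn u.fn := by
    rw [inner_conj_symm, inner_L2, inner_L2,
      ← integral_sub (integrable_mul_conj v.fn u.fn) (integrable_mul_conj u.fn v.fn)]
    simp only [mul_comm]
  rw [stokes2, h]
  simp only [Complex.mul_re, Complex.I_re, Complex.I_im, Complex.sub_im, Complex.conj_im,
    Complex.sub_re]
  ring

/-- The linear evolution of the Stokes variables stays bounded below the symmetry-breaking
threshold. -/
theorem stokes_bound {κ γ : ℝ} (hγ : 0 ≤ γ) (hlt : γ < κ) {A B m : ℝ → ℝ}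
    (hA : ∀ t, HasDerivAt A (2 * (γ * A t - κ * m t)) t)
    (hB : ∀ t, HasDerivAt B (2 * (-γ * B t + κ * m t)) t)
    (hm : ∀ t, HasDerivAt m (κ * (A t - B t)) t) (t : ℝ) :
    A t + B t ≤ κ * (κ * (A 0 + B 0) - γ * (2 * m 0)) / √(κ ^ 2 - γ ^ 2) ^ 2 +
      √((A 0 + B 0 - κ * (κ * (A 0 + B 0) - γ * (2 * m 0)) / √(κ ^ 2 - γ ^ 2) ^ 2) ^ 2 +
        (2 * γ * (A 0 - B 0) / (2 * √(κ ^ 2 - γ ^ 2))) ^ 2) := by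
  set ω := √(κ ^ 2 - γ ^ 2) with hω
  have hpos : 0 < κ ^ 2 - γ ^ 2 := by nlinarith
  have hω2 : ω ^ 2 = κ ^ 2 - γ ^ 2 := Real.sq_sqrt hpos.le
  have hω0 : 0 < ω := Real.sqrt_pos.2 hpos
  set C := κ * (A 0 + B 0) - γ * (2 * m 0) with hCdef
  have hQ : ∀ t, HasDerivAt (fun t => A t + B t) (2 * γ * (A t - B t)) t := fun t =>
    ((hA t).add (hB t)).congr_deriv (by ring)
  have hS : ∀ t, HasDerivAt (fun t => A t - B t) (2 * γ * (A t + B t) - 4 * κ * m t) t := fun t =>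
    ((hA t).sub (hB t)).congr_deriv (by ring)
  have hC : ∀ t, κ * (A t + B t) - γ * (2 * m t) = C := by
    have hd : ∀ t, HasDerivAt (fun t => κ * (A t + B t) - γ * (2 * m t)) 0 t := fun t =>
      (((hQ t).const_mul κ).sub (((hm t).const_mul 2).const_mul γ)).congr_deriv (by ring)
    intro t
    exact is_const_of_deriv_eq_zero (fun t => (hd t).differentiableAt) (fun t => (hd t).deriv) t 0
  set c := κ * C / ω ^ 2 with hc
  have hcC : c * ω ^ 2 = κ * C := by rw [hc]; field_simp
  have hE : ∀ t, (A t + B t - c) ^ 2 + (γ * (A t - B t) / ω) ^ 2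
      = (A 0 + B 0 - c) ^ 2 + (γ * (A 0 - B 0) / ω) ^ 2 := by
    have hd : ∀ t, HasDerivAt (fun t => (A t + B t - c) ^ 2 + (γ * (A t - B t) / ω) ^ 2) 0 t := by
      intro t
      refine ((((hQ t).sub_const c).pow 2).add ((((hS t).const_mul γ).div_const ω).pow 2)).congr_deriv ?_
      have h4 : γ * (2 * m t) = κ * (A t + B t) - C := by linarith [hC t]
      -- Eliminating `m` through the conserved `C` leaves an oscillator for `Q` about the
      -- equilibrium `c`: `Q' = 2γ S₃` and `γ S₃' = -2ω² (Q - c)`.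
      have h5 : γ * (2 * γ * (A t + B t) - 4 * κ * m t) = -2 * ω ^ 2 * (A t + B t - c) := by
        rw [mul_sub (-2 * ω ^ 2), show -2 * ω ^ 2 * c = -2 * (c * ω ^ 2) by ring, hcC, hω2]
        linear_combination -2 * κ * h4
      rw [h5]
      have hne : ω ≠ 0 := hω0.ne'
      clear_value ω c
      clear hω hc
      have e : γ * (A t - B t) / ω * (-2 * ω ^ 2 * (A t + B t - c) / ω)
          = -2 * (γ * (A t - B t)) * (A t + B t - c) := by
        field_simp
      push_cast
      linear_combination 2 * e
    intro t
    exact is_const_of_deriv_eq_zero (fun t => (hd t).differentiableAt) (fun t => (hd t).deriv) t 0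
  have hle : A t + B t - c ≤ √((A 0 + B 0 - c) ^ 2 + (γ * (A 0 - B 0) / ω) ^ 2) := by
    apply Real.le_sqrt_of_sq_le
    rw [← hE t]
    nlinarith [sq_nonneg (γ * (A t - B t) / ω)]
  have e : 2 * γ * (A 0 - B 0) / (2 * ω) = γ * (A 0 - B 0) / ω := by
    field_simp
  rw [e]
  linarith

/-- The explicit bound of the total power for global solutions in the unbroken phase. -/
theorem IsGlobalSolution.totalPower_le {g κ γ : ℝ} (hγ : 0 ≤ γ) (hlt : γ < κ) {u v : ℝ → H1}
    (h : IsGlobalSolution g g g κ γ u v) (t : ℝ) :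
    totalPower (u t) (v t) ≤ Qmax κ γ (u 0) (v 0) := by
  let Nu : ℝ → H1 → ℂ := fun t w => ∫ x : ℝ, ((g * ‖(u t).fn x‖ ^ 2 + g * ‖(v t).fn x‖ ^ 2 : ℝ) : ℂ)
            * (u t).fn x * conj (w.fn x)
  let Nv : ℝ → H1 → ℂ := fun t w => ∫ x : ℝ, ((g * ‖(u t).fn x‖ ^ 2 + g * ‖(v t).fn x‖ ^ 2 : ℝ) : ℂ)
            * (v t).fn x * conj (w.fn x)
  have hu : ∀ (t : ℝ) (w : H1), HasDerivAt (fun s => inner ℂ w.fn (u s).fn)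
      (-Complex.I * (inner ℂ w.dx (u t).dx + κ * inner ℂ w.fn (v t).fn
        + Complex.I * γ * inner ℂ w.fn (u t).fn - Nu t w)) t := by
    intro t w
    refine ((h.eq_u t w).const_mul (-Complex.I)).congr_of_eventuallyEq
      (Eventually.of_forall fun s => ?_)
    simp only [← mul_assoc, neg_mul, Complex.I_mul_I, neg_neg, one_mul]
  have hv : ∀ (t : ℝ) (w : H1), HasDerivAt (fun s => inner ℂ w.fn (v s).fn)
      (-Complex.I * (inner ℂ w.dx (v t).dx + κ * inner ℂ w.fn (u t).fn
        - Complex.I * γ * inner ℂ w.fn (v t).fn - Nv t w)) t := by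
    intro t w
    refine ((h.eq_v t w).const_mul (-Complex.I)).congr_of_eventuallyEq
      (Eventually.of_forall fun s => ?_)
    simp only [← mul_assoc, neg_mul, Complex.I_mul_I, neg_neg, one_mul]
  have hreal : ∀ (c : ℝ → ℝ) (f : L2),
      (∫ x : ℝ, ((c x : ℝ) : ℂ) * f x * conj (f x)).im = 0 := by
    intro c f
    have : ∫ x : ℝ, ((c x : ℝ) : ℂ) * f x * conj (f x) = ((∫ x : ℝ, c x * ‖f x‖ ^ 2 : ℝ) : ℂ) := by
      rw [← integral_complex_ofReal]
      refine integral_congr_ae (Eventually.of_forall fun x => ?_)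
      simp only [mul_assoc, Complex.mul_conj, Complex.normSq_eq_norm_sq]
      push_cast
      rfl
    rw [this, Complex.ofReal_im]
  have hselfre : ∀ f : L2, (inner ℂ f f).re = ‖f‖ ^ 2 := fun f => inner_self_eq_norm_sq (𝕜 := ℂ) f
  -- This cancels the nonlinear terms in the derivative of `⟨v, u⟩`; it relies on `u` and `v` seeing
  -- the same potential, that is, on equal coefficients.
  have hNuv : ∀ t, conj (Nv t (u t)) = Nu t (v t) := by
    intro t
    simp only [Nv, Nu]
    rw [← integral_conj]
    refine integral_congr_ae (Eventually.of_forall fun x => ?_)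
    simp only [map_mul, Complex.conj_conj, Complex.conj_ofReal]
    ring
  have hA : ∀ t, HasDerivAt (fun t => ‖(u t).fn‖ ^ 2)
      (2 * (γ * ‖(u t).fn‖ ^ 2 - κ * (inner ℂ (v t).fn (u t).fn).im)) t := by
    intro t
    have h1 := hasDerivAt_inner_of_weak h.continuous_u.continuousAt (hu t) (hu t)
    have h2 := (Complex.reCLM.hasFDerivAt.comp_hasDerivAt t h1)
    refine (h2.congr_of_eventuallyEq (Eventually.of_forall fun s => (hselfre _).symm)).congr_deriv ?_
    have e := congrArg Complex.im (inner_conj_symm (𝕜 := ℂ) (u t).fn (v t).fn)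
    have e3 := hselfre (u t).fn
    have e4 : (Nu t (u t)).im = 0 := hreal _ _
    rw [← e3]
    simp only [Complex.conj_im] at e
    simp [-inner_self_eq_norm_sq_to_K]
    rw [e4, ← e]
    ring
  have hB : ∀ t, HasDerivAt (fun t => ‖(v t).fn‖ ^ 2)
      (2 * (-γ * ‖(v t).fn‖ ^ 2 + κ * (inner ℂ (v t).fn (u t).fn).im)) t := by
    intro t
    have h1 := hasDerivAt_inner_of_weak h.continuous_v.continuousAt (hv t) (hv t)
    have h2 := (Complex.reCLM.hasFDerivAt.comp_hasDerivAt t h1)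
    refine (h2.congr_of_eventuallyEq (Eventually.of_forall fun s => (hselfre _).symm)).congr_deriv ?_
    have e := congrArg Complex.im (inner_conj_symm (𝕜 := ℂ) (u t).fn (v t).fn)
    simp only [Complex.conj_im] at e
    have e3 := hselfre (v t).fn
    have e4 : (Nv t (v t)).im = 0 := hreal _ _
    rw [← e3]
    simp [-inner_self_eq_norm_sq_to_K]
    rw [e4, ← e]
    ring
  have hm : ∀ t, HasDerivAt (fun t => (inner ℂ (v t).fn (u t).fn).im)
      (κ * (‖(u t).fn‖ ^ 2 - ‖(v t).fn‖ ^ 2)) t := by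
    intro t
    have h1 := hasDerivAt_inner_of_weak h.continuous_v.continuousAt (hu t) (hv t)
    have h2 := (Complex.imCLM.hasFDerivAt.comp_hasDerivAt t h1)
    refine h2.congr_deriv ?_
    simp only [map_mul, map_neg, map_add, map_sub, Complex.conj_I, inner_conj_symm, hNuv,
      Complex.conj_ofReal]
    rw [← hselfre, ← hselfre]
    simp [-inner_self_eq_norm_sq_to_K]
    ring
  have := stokes_bound hγ hlt hA hB hm t
  simpa only [Qmax, totalPower, stokes2_eq, stokes3_eq] using this

/-! ### Global solutions of ordinary differential equations from a priori bounds -/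

section GlobalODE

variable {E : Type*} [NormedAddCommGroup E] [NormedSpace ℝ E]

/-- Concatenation of two solutions of an ordinary differential equation. -/
theorem exists_glue_hasDerivAt {f : ℝ → E → E} {α β : ℝ → E} {a b c d p : ℝ}
    (hα : ∀ t ∈ Set.Ioo a b, HasDerivAt α (f t (α t)) t)
    (hβ : ∀ t ∈ Set.Ioo c d, HasDerivAt β (f t (β t)) t)
    (hp : p ∈ Set.Ioo a b) (hp' : p ∈ Set.Ioo c d) (h : α p = β p) :
    ∃ g : ℝ → E, (∀ t ≤ p, g t = α t) ∧ (∀ t, p ≤ t → g t = β t) ∧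
      ∀ t ∈ Set.Ioo a d, HasDerivAt g (f t (g t)) t := by
  let g : ℝ → E := fun t => if t ≤ p then α t else β t
  have h1 : ∀ t ≤ p, g t = α t := fun t ht => if_pos ht
  have h2 : ∀ t, p ≤ t → g t = β t := by
    intro t ht
    rcases ht.eq_or_lt with rfl | ht
    · rw [h1 _ le_rfl, h]
    · exact if_neg (not_le.2 ht)
  refine ⟨g, h1, h2, fun t ht => ?_⟩
  rcases lt_trichotomy t p with hlt | rfl | hlt
  · rw [h1 t hlt.le]
    exact (hα t ⟨ht.1, hlt.trans hp.2⟩).congr_of_eventuallyEq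
      (Filter.eventuallyEq_of_mem (Iio_mem_nhds hlt) fun s hs => h1 s (le_of_lt hs))
  · have d1 : HasDerivWithinAt g (f t (g t)) (Set.Iic t) t := by
      rw [h1 t le_rfl]
      exact (hα t hp).hasDerivWithinAt.congr (fun s hs => h1 s hs) (h1 t le_rfl)
    have d2 : HasDerivWithinAt g (f t (g t)) (Set.Ici t) t := by
      rw [h2 t le_rfl]
      exact (hβ t hp').hasDerivWithinAt.congr (fun s hs => h2 s hs) (h2 t le_rfl)
    have := d1.union d2
    rwa [Set.Iic_union_Ici, hasDerivWithinAt_univ] at this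
  · rw [h2 t hlt.le]
    exact (hβ t ⟨hp'.1.trans hlt, ht.2⟩).congr_of_eventuallyEq
      (Filter.eventuallyEq_of_mem (Ioi_mem_nhds hlt) fun s hs => h2 s (le_of_lt hs))

/-- If the vector field is Lipschitz on balls, locally uniformly in time, then the existence time is
uniform over balls. -/
theorem exists_uniform_time [CompleteSpace E] {f : ℝ → E → E}
    (hlip : ∀ R T : ℝ, ∃ K : NNReal, ∀ t ∈ Set.Icc (-T) T,
      LipschitzOnWith K (f t) (Metric.closedBall 0 R))
    (hcont : ∀ x, Continuous fun t => f t x) (R T : ℝ) :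
    ∃ δ > 0, ∀ t₀ ∈ Set.Icc (-T) T, ∀ x₀ ∈ Metric.closedBall (0 : E) R,
      ∃ α : ℝ → E, α t₀ = x₀ ∧ ∀ t ∈ Set.Ioo (t₀ - δ) (t₀ + δ), HasDerivAt α (f t (α t)) t := by
  -- The margin of 1 in space and time leaves room for a unit ball around each initial value and for
  -- `δ ≤ 1`. A speed of at most `L` for time `1 / (L + 1)` does not leave that ball.
  obtain ⟨K, hK⟩ := hlip (|R| + 1) (T + 1)
  obtain ⟨M, hM⟩ := (isCompact_Icc (a := -(T + 1)) (b := T + 1)).exists_bound_of_continuousOn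
    (hcont 0).continuousOn
  let L : NNReal := ⟨|M| + K * (|R| + 1), by positivity⟩
  have hL : ∀ t ∈ Set.Icc (-(T + 1)) (T + 1), ∀ x ∈ Metric.closedBall (0 : E) (|R| + 1),
      ‖f t x‖ ≤ L := by
    intro t ht x hx
    have h0 : (0 : E) ∈ Metric.closedBall (0 : E) (|R| + 1) :=
      Metric.mem_closedBall_self (by positivity)
    have h1 := (hK t ht).dist_le_mul x hx 0 h0
    rw [dist_eq_norm, dist_zero_right] at h1
    rw [mem_closedBall_zero_iff] at hx
    calc ‖f t x‖ ≤ ‖f t 0‖ + ‖f t x - f t 0‖ := norm_le_insert' _ _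
      _ ≤ |M| + K * (|R| + 1) := add_le_add ((hM t ht).trans (le_abs_self M))
          (h1.trans (mul_le_mul_of_nonneg_left hx K.2))
  have hLpos : (0 : ℝ) < L + 1 := by positivity
  refine ⟨1 / (L + 1), by positivity, fun t₀ ht₀ x₀ hx₀ => ?_⟩
  have hδ1 : 1 / ((L : ℝ) + 1) ≤ 1 := by
    rw [div_le_one hLpos]; linarith [L.2]
  have hδ0 : 0 < 1 / ((L : ℝ) + 1) := by positivity
  set δ := 1 / ((L : ℝ) + 1) with hδ
  have hsub : ∀ t ∈ Set.Icc (t₀ - δ) (t₀ + δ), t ∈ Set.Icc (-(T + 1)) (T + 1) := fun t ht =>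
    ⟨by linarith [ht.1, ht₀.1], by linarith [ht.2, ht₀.2]⟩
  have hball : Metric.closedBall x₀ ((1 : NNReal) : ℝ) ⊆ Metric.closedBall (0 : E) (|R| + 1) := by
    refine Metric.closedBall_subset_closedBall' ?_
    rw [Metric.mem_closedBall] at hx₀
    have := le_abs_self R
    push_cast
    linarith
  have hPL : IsPicardLindelof f (tmin := t₀ - δ) (tmax := t₀ + δ)
      ⟨t₀, by constructor <;> linarith⟩ x₀ 1 0 L K :=
    { lipschitzOnWith := fun t ht => (hK t (hsub t ht)).mono hball
      continuousOn := fun x _ => (hcont x).continuousOn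
      norm_le := fun t ht x hx => hL t (hsub t ht) x (hball hx)
      mul_max_le := by
        have : max (t₀ + δ - t₀) (t₀ - (t₀ - δ)) = δ := by
          rw [add_sub_cancel_left, sub_sub_cancel, max_self]
        simp only [this]
        rw [hδ, mul_one_div, div_le_iff₀ hLpos]
        push_cast
        linarith }
  obtain ⟨α, h1, h2⟩ := hPL.exists_eq_forall_mem_Icc_hasDerivWithinAt₀
  exact ⟨α, h1, fun t ht => (h2 t (Set.Ioo_subset_Icc_self ht)).hasDerivAt
    (Icc_mem_nhds ht.1 ht.2)⟩

/-- A vector field which is Lipschitz on balls has a global solution as soon as its solutions are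
bounded a priori on bounded time intervals. -/
theorem exists_global_of_apriori_bound [CompleteSpace E] {f : ℝ → E → E} {x₀ : E}
    (hlip : ∀ R T : ℝ, ∃ K : NNReal, ∀ t ∈ Set.Icc (-T) T,
      LipschitzOnWith K (f t) (Metric.closedBall 0 R))
    (hcont : ∀ x, Continuous fun t => f t x)
    (hbound : ∀ T : ℝ, ∃ R : ℝ, ∀ τ ≤ T, ∀ α : ℝ → E, α 0 = x₀ →
      (∀ t ∈ Set.Ioo (-τ) τ, HasDerivAt α (f t (α t)) t) → ∀ t ∈ Set.Ioo (-τ) τ, ‖α t‖ ≤ R) :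
    ∃ α : ℝ → E, α 0 = x₀ ∧ ∀ t, HasDerivAt α (f t (α t)) t := by
  -- The Lipschitz constants exist on balls only, so uniqueness too uses the a priori bound to
  -- confine both solutions.
  have huniq : ∀ τ : ℝ, ∀ α β : ℝ → E, α 0 = x₀ → β 0 = x₀ →
      (∀ t ∈ Set.Ioo (-τ) τ, HasDerivAt α (f t (α t)) t) →
      (∀ t ∈ Set.Ioo (-τ) τ, HasDerivAt β (f t (β t)) t) → Set.EqOn α β (Set.Ioo (-τ) τ) := by
    intro τ α β hα hβ hα' hβ'
    by_cases hτ : 0 < τ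
    swap
    · rw [Set.Ioo_eq_empty (by linarith)]; exact Set.eqOn_empty _ _
    obtain ⟨R, hR⟩ := hbound τ
    obtain ⟨K, hK⟩ := hlip R τ
    exact ODE_solution_unique_of_mem_Ioo (v := f) (s := fun _ => Metric.closedBall 0 R) (K := K)
      (t₀ := 0) (fun t ht => hK t (Set.Ioo_subset_Icc_self ht)) ⟨by linarith, hτ⟩
      (fun t ht => ⟨hα' t ht, mem_closedBall_zero_iff.2 (hR τ le_rfl α hα hα' t ht)⟩)
      (fun t ht => ⟨hβ' t ht, mem_closedBall_zero_iff.2 (hR τ le_rfl β hβ hβ' t ht)⟩)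
      (hα.trans hβ.symm)
  have hex : ∀ T : ℝ, 0 < T → ∃ α : ℝ → E, α 0 = x₀ ∧
      ∀ t ∈ Set.Ioo (-T) T, HasDerivAt α (f t (α t)) t := by
    intro T hT
    obtain ⟨R, hR⟩ := hbound T
    obtain ⟨δ, hδ, hloc⟩ := exists_uniform_time hlip hcont (max R ‖x₀‖) T
    -- Since `R` serves every `τ ≤ T`, one `δ` serves every restart, and each step lengthens the
    -- interval by `δ / 2` on both sides.
    have hstep : ∀ n : ℕ, ∃ τ : ℝ, 0 < τ ∧ (T ≤ τ ∨ (n : ℝ) * (δ / 2) ≤ τ) ∧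
        ∃ α : ℝ → E, α 0 = x₀ ∧ ∀ t ∈ Set.Ioo (-τ) τ, HasDerivAt α (f t (α t)) t := by
      intro n
      induction n with
      | zero =>
        obtain ⟨α, h1, h2⟩ := hloc 0 ⟨by linarith, hT.le⟩ x₀ (by simp)
        exact ⟨δ, hδ, Or.inr (by simp [hδ.le]), α, h1, by simpa using h2⟩
      | succ n ih =>
        obtain ⟨τ, hτ, hn, α, hα, hα'⟩ := ih
        by_cases hTτ : T ≤ τ
        · exact ⟨τ, hτ, Or.inl hTτ, α, hα, hα'⟩
        replace hn := hn.resolve_left hTτ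
        rw [not_le] at hTτ
        have hαR := hR τ hTτ.le α hα hα'
        -- The restart point lies strictly inside the interval, because nothing is known at the
        -- endpoint `τ`, but within `δ / 2` of it.
        obtain ⟨p, hp0, hpτ, hpδ⟩ : ∃ p, 0 < p ∧ p < τ ∧ τ + δ / 2 ≤ p + δ := by
          refine ⟨max (τ / 2) (τ - δ / 2), ?_, ?_, ?_⟩
          · exact lt_max_of_lt_left (by linarith)
          · exact max_lt (by linarith) (by linarith)
          · linarith [le_max_right (τ / 2) (τ - δ / 2)]
        obtain ⟨β, hβ, hβ'⟩ := hloc p ⟨by linarith, by linarith⟩ (α p)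
          (mem_closedBall_zero_iff.2 ((hαR p ⟨by linarith, hpτ⟩).trans (le_max_left _ _)))
        obtain ⟨g, hg1, hg2, hg'⟩ := exists_glue_hasDerivAt hα' hβ' ⟨by linarith, hpτ⟩
          ⟨by linarith, by linarith⟩ hβ.symm
        obtain ⟨β₂, hβ₂, hβ₂'⟩ := hloc (-p) ⟨by linarith, by linarith⟩ (α (-p))
          (mem_closedBall_zero_iff.2 ((hαR (-p) ⟨by linarith, by linarith⟩).trans (le_max_left _ _)))
        obtain ⟨k, hk1, hk2, hk'⟩ := exists_glue_hasDerivAt hβ₂' hg' (p := -p)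
          ⟨by linarith, by linarith⟩ ⟨by linarith, by linarith⟩
          (hβ₂.trans (hg1 _ (by linarith)).symm)
        refine ⟨τ + δ / 2, by linarith, Or.inr ?_, k, ?_, fun t ht => hk' t ⟨?_, ?_⟩⟩
        · push_cast; linarith
        · rw [hk2 0 (by linarith), hg1 0 hp0.le, hα]
        · linarith [ht.1]
        · linarith [ht.2]
    obtain ⟨n, hn⟩ := exists_nat_ge (T / (δ / 2))
    obtain ⟨τ, hτ, h, α, hα, hα'⟩ := hstep n
    have hTτ : T ≤ τ := by
      rcases h with h | h
      · exact h
      · rw [div_le_iff₀ (by linarith)] at hn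
        linarith
    exact ⟨α, hα, fun t ht => hα' t ⟨by linarith [ht.1], by linarith [ht.2]⟩⟩
  choose A hA0 hA using fun n : ℕ => hex ((n : ℝ) + 1) (by positivity)
  refine ⟨fun t => A ⌈|t|⌉₊ t, hA0 _, fun t => ?_⟩
  have habs : |t| < (⌈|t|⌉₊ : ℝ) + 1 := (Nat.le_ceil _).trans_lt (lt_add_one _)
  have hmem : ∀ s : ℝ, s ∈ Set.Ioo (-((⌈|s|⌉₊ : ℝ) + 1)) ((⌈|s|⌉₊ : ℝ) + 1) := fun s =>
    abs_lt.1 ((Nat.le_ceil _).trans_lt (lt_add_one _))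
  refine (hA ⌈|t|⌉₊ t (hmem t)).congr_of_eventuallyEq ?_
  filter_upwards [Ioo_mem_nhds (hmem t).1 (hmem t).2] with s hs
  rcases le_total ⌈|s|⌉₊ ⌈|t|⌉₊ with hle | hle
  · have hle' : (⌈|s|⌉₊ : ℝ) ≤ ⌈|t|⌉₊ := by exact_mod_cast hle
    exact huniq _ _ _ (hA0 _) (hA0 _) (hA _)
      (fun r hr => hA _ r ⟨by linarith [hr.1], by linarith [hr.2]⟩) (hmem s)
  · have hle' : (⌈|t|⌉₊ : ℝ) ≤ ⌈|s|⌉₊ := by exact_mod_cast hle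
    exact huniq _ _ _ (hA0 _) (hA0 _)
      (fun r hr => hA _ r ⟨by linarith [hr.1], by linarith [hr.2]⟩) (hA _) hs

end GlobalODE

/-! ### Global well-posedness of the cubic equation with time-dependent coefficient -/

theorem inner_freeL2_freeL2 (t : ℝ) (f g : L2) :
    inner ℂ (freeL2 t f) (freeL2 t g) = inner ℂ f g :=
  LinearIsometry.inner_map_map (⟨freeL2 t, norm_freeL2 t⟩ : L2 →ₗᵢ[ℂ] L2) f g

namespace H1

theorem norm_cubic_fn_le (f : H1) : ‖(cubic f).fn‖ ≤ 2 * ‖f.fn‖ * ‖f.dx‖ * ‖f.fn‖ := by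
  refine Lp.norm_le_mul_norm_of_ae_le_mul ?_
  filter_upwards [cubic_fn_coe f, norm_sq_le_ae f] with x h1 h2
  rw [h1, norm_mul, Complex.norm_real, Real.norm_of_nonneg (sq_nonneg _)]
  exact mul_le_mul_of_nonneg_right h2 (norm_nonneg _)

theorem inner_cubic_im (f : H1) : (inner ℂ f.fn (cubic f).fn).im = 0 := by
  have : inner ℂ f.fn (cubic f).fn = ((∫ x : ℝ, ‖f.fn x‖ ^ 2 * ‖f.fn x‖ ^ 2 : ℝ) : ℂ) := by
    rw [inner_L2, ← integral_complex_ofReal]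
    refine integral_congr_ae ?_
    filter_upwards [cubic_fn_coe f] with x h
    rw [h, mul_assoc, Complex.mul_conj, Complex.normSq_eq_norm_sq]
    push_cast
    ring
  rw [this, Complex.ofReal_im]

/-- The quartic functional `∫ |f|⁴`. -/
noncomputable def quartic (f : H1) : ℝ := (inner ℂ f.fn (cubic f).fn).re

/-- A Gagliardo–Nirenberg bound: the derivative enters to the first power only, so the kinetic
energy absorbs the quartic term for either sign of the coefficient. -/
theorem abs_quartic_le (f : H1) : |quartic f| ≤ 2 * ‖f.fn‖ ^ 3 * ‖f.dx‖ := by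
  calc |quartic f| ≤ ‖inner ℂ f.fn (cubic f).fn‖ := Complex.abs_re_le_norm _
    _ ≤ ‖f.fn‖ * ‖(cubic f).fn‖ := norm_inner_le_norm _ _
    _ ≤ ‖f.fn‖ * (2 * ‖f.fn‖ * ‖f.dx‖ * ‖f.fn‖) := by gcongr; exact norm_cubic_fn_le f
    _ = _ := by ring

/-- The divided difference `(|f|² + |g|²)(f + g)` of the quartic functional. -/
noncomputable def quarticDiff (f g : H1) : H1 := tri f f (f + g) + tri g g (f + g)

theorem quarticDiff_coe (f g : H1) : (quarticDiff f g).fn =ᵐ[volume]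
    fun x => (f.fn x * conj (f.fn x) + g.fn x * conj (g.fn x)) * (f.fn x + g.fn x) := by
  rw [quarticDiff, fn_add]
  filter_upwards [tri_fn_coe f f (f + g), tri_fn_coe g g (f + g), Lp.coeFn_add f.fn g.fn,
    Lp.coeFn_add (tri f f (f + g)).fn (tri g g (f + g)).fn] with x h1 h2 h3 h4
  rw [h4, Pi.add_apply, h1, h2, fn_add, h3, Pi.add_apply]
  ring

theorem quarticDiff_self (f : H1) : quarticDiff f f = (4 : ℂ) • cubic f := by
  apply ext_ae
  rw [fn_smul]
  filter_upwards [quarticDiff_coe f f, tri_fn_coe f f f, Lp.coeFn_smul (4 : ℂ) (cubic f).fn]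
    with x h1 h2 h3
  rw [h1, h3, Pi.smul_apply, cubic, h2, smul_eq_mul]
  ring

theorem continuous_quarticDiff (g : H1) : Continuous fun f => quarticDiff f g := by
  have h0 : Continuous fun f : H1 => f + g := continuous_id.add continuous_const
  have h1 : Continuous fun f : H1 => tri f f (f + g) :=
    continuous_tri.comp (continuous_id.prodMk (continuous_id.prodMk h0))
  have h2 : Continuous fun f : H1 => tri g g (f + g) :=
    continuous_tri.comp (continuous_const.prodMk (continuous_const.prodMk h0))
  exact h1.add h2

/-- Pointwise, `|a|⁴ - |b|⁴` is the real part of `(|a|² + |b|²)(a - b)` times the conjugate of `a +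
b`. The quartic functional can thus be differentiated along a curve that is differentiable only
weakly, by `tendsto_inner_slope`. -/
theorem quartic_sub (f g : H1) :
    quartic f - quartic g = (inner ℂ (quarticDiff f g).fn (f.fn - g.fn)).re := by
  have key : inner ℂ (quarticDiff f g).fn (f.fn - g.fn) + inner ℂ (f.fn - g.fn) (quarticDiff f g).fn
      = 2 * (inner ℂ f.fn (cubic f).fn - inner ℂ g.fn (cubic g).fn) := by
    rw [inner_L2, inner_L2, inner_L2, inner_L2,
      ← integral_add (integrable_mul_conj _ _) (integrable_mul_conj _ _),
      ← integral_sub (integrable_mul_conj _ _) (integrable_mul_conj _ _), ← integral_const_mul]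
    refine integral_congr_ae ?_
    filter_upwards [quarticDiff_coe f g, Lp.coeFn_sub f.fn g.fn, tri_fn_coe f f f,
      tri_fn_coe g g g] with x h1 h2 h3 h4
    rw [h1, h2, Pi.sub_apply, cubic, cubic, h3, h4]
    simp only [map_mul, map_add, map_sub, Complex.conj_conj]
    ring
  have h := congrArg Complex.re key
  have h2 := congrArg Complex.re
    (inner_conj_symm (𝕜 := ℂ) (quarticDiff f g).fn (f.fn - g.fn))
  simp only [Complex.add_re, Complex.mul_re, Complex.sub_re, Complex.re_ofNat, Complex.im_ofNat,
    zero_mul, sub_zero] at h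
  rw [Complex.conj_re] at h2
  rw [quartic, quartic]
  linarith

/-- The vector field of the cubic Schrödinger equation in the interaction picture. -/
noncomputable def nlsField (G : ℝ → ℝ) (t : ℝ) (f : H1) : H1 :=
  (Complex.I * G t) • free (-t) (cubic (free t f))

theorem free_nlsField (G : ℝ → ℝ) (t : ℝ) (f : H1) :
    free t (nlsField G t f) = (Complex.I * G t) • cubic (free t f) := by
  rw [nlsField, map_smul, free_free_neg]

theorem continuous_nlsField {G : ℝ → ℝ} (hG : Continuous G) (f : H1) :
    Continuous fun t => nlsField G t f := by
  have h1 : Continuous fun t => cubic (free t f) := continuous_cubic.comp (continuous_free_apply f)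
  have h2 : Continuous fun t : ℝ => free (-t) (cubic (free t f)) :=
    continuous_free.comp (continuous_neg.prodMk h1)
  exact (continuous_const.mul (Complex.continuous_ofReal.comp hG)).smul h2

theorem exists_lipschitz_nlsField {G : ℝ → ℝ} (hG : Continuous G) (R T : ℝ) :
    ∃ K : NNReal, ∀ t ∈ Set.Icc (-T) T, LipschitzOnWith K (nlsField G t) (Metric.closedBall 0 R) := by
  obtain ⟨M, hM⟩ := (isCompact_Icc (a := -T) (b := T)).exists_bound_of_continuousOn hG.continuousOn
  refine ⟨⟨|M| * (27 * R ^ 2), by positivity⟩, fun t ht => LipschitzOnWith.of_dist_le_mul ?_⟩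
  intro f hf g hg
  rw [mem_closedBall_zero_iff] at hf hg
  rw [dist_eq_norm, dist_eq_norm, nlsField, nlsField, ← smul_sub, ← map_sub, norm_smul,
    LinearIsometry.norm_map, norm_mul, Complex.norm_I, one_mul, Complex.norm_real]
  have h := norm_cubic_sub_le (R := R) (f := free t f) (g := free t g)
    (by rwa [LinearIsometry.norm_map]) (by rwa [LinearIsometry.norm_map])
  rw [← map_sub, LinearIsometry.norm_map] at h
  calc ‖G t‖ * ‖cubic (free t f) - cubic (free t g)‖ ≤ |M| * (27 * R ^ 2 * ‖f - g‖) :=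
        mul_le_mul ((hM t ht).trans (le_abs_self M)) h (norm_nonneg _) (abs_nonneg _)
    _ = _ := by rw [← mul_assoc]; rfl

attribute [irreducible] nlsField

/-! ### Mass and energy along trajectories of the interaction picture -/

section Trajectory

variable {G : ℝ → ℝ} {α : ℝ → H1} {t : ℝ}

theorem continuousAt_free_trajectory (hα : ContinuousAt α t) :
    ContinuousAt (fun s => free s (α s)) t :=
  continuous_free.continuousAt.comp (f := fun s => (s, α s)) (continuousAt_id.prodMk hα)

/-- In the original picture, trajectories of `nlsField` are weak solutions of the cubic equation. -/
theorem hasDerivAt_inner_trajectory (hα : HasDerivAt α (nlsField G t (α t)) t) (w : H1) :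
    HasDerivAt (fun s => inner ℂ w.fn (free s (α s)).fn)
      (-Complex.I * inner ℂ w.dx (free t (α t)).dx
        + Complex.I * G t * inner ℂ w.fn (cubic (free t (α t))).fn) t := by
  rw [hasDerivAt_iff_tendsto_slope]
  have h1 := hasDerivAt_iff_tendsto_slope.1 (hasDerivAt_inner_free (α t) w t)
  -- The quotient of `free s (α s)` splits into the free evolution of the frozen state `α t` and
  -- `free s` applied to the quotient of `α`; joint continuity of `free` handles the latter.
  have h2 : Tendsto (fun s => inner ℂ w.fn (free s (slope α t s)).fn) (𝓝[≠] t)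
      (𝓝 (inner ℂ w.fn (free t (nlsField G t (α t))).fn)) := by
    have hc := fnL.continuous.comp continuous_free
    have h3 : Tendsto (fun s => (s, slope α t s)) (𝓝[≠] t) (𝓝 (t, nlsField G t (α t))) := by
      rw [nhds_prod_eq]
      exact (tendsto_id.mono_left nhdsWithin_le_nhds).prodMk (hasDerivAt_iff_tendsto_slope.1 hα)
    exact tendsto_const_nhds.inner ((hc.tendsto (t, nlsField G t (α t))).comp h3)
  rw [free_nlsField, fn_smul, inner_smul_right] at h2
  refine (h1.add h2).congr fun s => ?_
  have e : free s (slope α t s) = (((s - t)⁻¹ : ℝ) : ℂ) • (free s (α s) - free s (α t)) := by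
    rw [← map_sub, ← map_smul, slope_def_module]
    congr 1
  rw [e, fn_smul, fn_sub, inner_smul_right, inner_sub_right, slope_def_module, slope_def_module,
    Complex.real_smul, Complex.real_smul]
  ring

theorem hasDerivAt_norm_sq_of_inner {f : ℝ → L2} {f' : L2} (hf : HasDerivAt f f' t) :
    HasDerivAt (fun s => ‖f s‖ ^ 2) (2 * (inner ℂ (f t) f').re) t := by
  have h := Complex.reCLM.hasFDerivAt.comp_hasDerivAt t (hf.inner ℂ hf)
  refine (h.congr_of_eventuallyEq
    (Eventually.of_forall fun s => (inner_self_eq_norm_sq (𝕜 := ℂ) (f s)).symm)).congr_deriv ?_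
  have e := congrArg Complex.re (inner_conj_symm (𝕜 := ℂ) f' (f t))
  rw [Complex.conj_re] at e
  rw [map_add, Complex.reCLM_apply, Complex.reCLM_apply, ← e]
  ring

theorem hasDerivAt_mass (hα : HasDerivAt α (nlsField G t (α t)) t) :
    HasDerivAt (fun s => ‖(α s).fn‖ ^ 2) 0 t := by
  have h := hasDerivAt_norm_sq_of_inner (fnL.restrictScalars ℝ |>.hasFDerivAt.comp_hasDerivAt t hα)
  refine h.congr_deriv ?_
  change 2 * (inner ℂ (α t).fn (nlsField G t (α t)).fn).re = 0
  have e : inner ℂ (α t).fn (nlsField G t (α t)).fn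
      = Complex.I * G t * inner ℂ (free t (α t)).fn (cubic (free t (α t))).fn := by
    rw [← inner_freeL2_freeL2 t, ← free_fn, ← free_fn, free_nlsField, fn_smul, inner_smul_right]
  rw [e]
  simp [inner_cubic_im]

/-- The curve `α` is differentiable in `H1` itself, and `free` preserves the norm of the derivative.
The kinetic energy can therefore be differentiated without a second space derivative. -/
theorem hasDerivAt_kinetic (hα : HasDerivAt α (nlsField G t (α t)) t) :
    HasDerivAt (fun s => ‖(α s).dx‖ ^ 2)
      (2 * G t * (inner ℂ (cubic (free t (α t))).dx (free t (α t)).dx).im) t := by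
  have h := hasDerivAt_norm_sq_of_inner (dxL.restrictScalars ℝ |>.hasFDerivAt.comp_hasDerivAt t hα)
  refine h.congr_deriv ?_
  change 2 * (inner ℂ (α t).dx (nlsField G t (α t)).dx).re = _
  have e : inner ℂ (α t).dx (nlsField G t (α t)).dx
      = Complex.I * G t * inner ℂ (free t (α t)).dx (cubic (free t (α t))).dx := by
    rw [← inner_freeL2_freeL2 t, ← free_dx, ← free_dx, free_nlsField, dx_smul, inner_smul_right]
  have e2 := congrArg Complex.im
    (inner_conj_symm (𝕜 := ℂ) (cubic (free t (α t))).dx (free t (α t)).dx)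
  rw [Complex.conj_im] at e2
  rw [e, ← e2]
  simp
  ring

/-- The term pairing the cubic with itself is purely imaginary and drops out. What remains is the
flux of `hasDerivAt_kinetic` up to a factor, so the two cancel in the energy. -/
theorem hasDerivAt_quartic (hα : HasDerivAt α (nlsField G t (α t)) t) :
    HasDerivAt (fun s => quartic (free s (α s)))
      (4 * (inner ℂ (cubic (free t (α t))).dx (free t (α t)).dx).im) t := by
  rw [hasDerivAt_iff_tendsto_slope]
  have hc : ContinuousAt (fun s => quarticDiff (free s (α s)) (free t (α t))) t :=
    (continuous_quarticDiff (free t (α t))).continuousAt.comp (f := fun s => free s (α s))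
      (continuousAt_free_trajectory hα.continuousAt)
  have h := (Complex.continuous_re.tendsto _).comp
    (tendsto_inner_slope hc (fun w => hasDerivAt_inner_trajectory hα w))
  have hself : ∀ f : L2, (inner ℂ f f).im = 0 := fun f => inner_self_im (𝕜 := ℂ) f
  have e : (-Complex.I * inner ℂ (quarticDiff (free t (α t)) (free t (α t))).dx (free t (α t)).dx
        + Complex.I * G t * inner ℂ (quarticDiff (free t (α t)) (free t (α t))).fn
          (cubic (free t (α t))).fn).re
      = 4 * (inner ℂ (cubic (free t (α t))).dx (free t (α t)).dx).im := by
    have h0 := hself (cubic (free t (α t))).fn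
    rw [quarticDiff_self, fn_smul, dx_smul, inner_smul_left, inner_smul_left]
    simp [-inner_self_eq_norm_sq_to_K]
    right
    exact h0
  rw [e] at h
  refine h.congr fun s => ?_
  rw [slope_def_module, quartic_sub, Function.comp_apply, Complex.real_smul, Complex.re_ofReal_mul]
  rfl

/-- The energy of the cubic equation changes only through the coefficient. -/
theorem hasDerivAt_energy {G' : ℝ} (hG : HasDerivAt G G' t)
    (hα : HasDerivAt α (nlsField G t (α t)) t) :
    HasDerivAt (fun s => ‖(α s).dx‖ ^ 2 / 2 - G s / 4 * quartic (free s (α s)))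
      (-(G' / 4) * quartic (free t (α t))) t := by
  refine (((hasDerivAt_kinetic hα).div_const 2).sub
    ((hG.div_const 4).mul (hasDerivAt_quartic hα))).congr_deriv ?_
  ring

end Trajectory

end H1

/-! ### A priori bounds and global existence -/

/-- Grönwall's inequality on a symmetric interval. -/
theorem abs_le_exp_of_abs_deriv_le {F F' : ℝ → ℝ} {τ L : ℝ}
    (hF : ∀ t ∈ Set.Ioo (-τ) τ, HasDerivAt F (F' t) t)
    (hF' : ∀ t ∈ Set.Ioo (-τ) τ, |F' t| ≤ L * |F t|) :
    ∀ t ∈ Set.Ioo (-τ) τ, |F t| ≤ |F 0| * Real.exp (L * |t|) := by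
  have key : ∀ (H H' : ℝ → ℝ), (∀ t ∈ Set.Ioo (-τ) τ, HasDerivAt H (H' t) t) →
      (∀ t ∈ Set.Ioo (-τ) τ, |H' t| ≤ L * |H t|) → ∀ t ∈ Set.Ico 0 τ,
      |H t| ≤ |H 0| * Real.exp (L * t) := by
    intro H H' hH hH' t ht
    have hsub : ∀ s ∈ Set.Icc 0 t, s ∈ Set.Ioo (-τ) τ := fun s hs =>
      ⟨by linarith [hs.1, ht.1, ht.2], by linarith [hs.2, ht.2]⟩
    have := norm_le_gronwallBound_of_norm_deriv_right_le (f := H) (f' := H') (δ := |H 0|) (K := L)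
      (ε := 0) (a := 0) (b := t)
      (fun s hs => (hH s (hsub s hs)).continuousAt.continuousWithinAt)
      (fun s hs => (hH s (hsub s (Set.Ico_subset_Icc_self hs))).hasDerivWithinAt) le_rfl
      (fun s hs => by simpa using hH' s (hsub s (Set.Ico_subset_Icc_self hs))) t ⟨ht.1, le_rfl⟩
    rwa [gronwallBound_ε0, sub_zero] at this
  intro t ht
  rcases le_total 0 t with h | h
  · rw [abs_of_nonneg h]
    exact key F F' hF hF' t ⟨h, ht.2⟩
  · have := key (fun s => F (-s)) (fun s => -F' (-s))
      (fun s hs => by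
        have h1 := hF (-s) ⟨by linarith [hs.2], by linarith [hs.1]⟩
        exact (h1.comp s (hasDerivAt_neg s)).congr_deriv (by ring))
      (fun s hs => by
        rw [abs_neg]
        exact hF' (-s) ⟨by linarith [hs.2], by linarith [hs.1]⟩) (-t) ⟨by linarith, by linarith [ht.1]⟩
    rw [abs_of_nonpos h]
    simpa using this

namespace H1

/-- The a priori bound in `H¹(ℝ)` from mass and energy. -/
theorem exists_apriori_bound {G G' : ℝ → ℝ} (hG : ∀ t, HasDerivAt G (G' t) t)
    (hG' : Continuous G') (f₀ : H1) (T : ℝ) :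
    ∃ R : ℝ, ∀ τ ≤ T, ∀ α : ℝ → H1, α 0 = f₀ →
      (∀ t ∈ Set.Ioo (-τ) τ, HasDerivAt α (nlsField G t (α t)) t) →
      ∀ t ∈ Set.Ioo (-τ) τ, ‖α t‖ ≤ R := by
  have hGc : Continuous G := continuous_iff_continuousAt.2 fun t => (hG t).continuousAt
  obtain ⟨M₀, hM₀⟩ := (isCompact_Icc (a := -T) (b := T)).exists_bound_of_continuousOn
    hGc.continuousOn
  obtain ⟨M₁, hM₁⟩ := (isCompact_Icc (a := -T) (b := T)).exists_bound_of_continuousOn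
    hG'.continuousOn
  set m := ‖f₀.fn‖ with hm
  -- With `y = ‖α_x‖`, the potential energy is at most `b y ≤ y²/4 + b²`, and the energy changes at
  -- rate at most `L y`. The shift `b² + 1` makes `F ≥ y²/4 + 1 ≥ y`, so `|F'| ≤ L |F|`.
  set b := |M₀| * m ^ 3 / 2 with hb
  set L := |M₁| * m ^ 3 / 2 with hL
  set F₀ := ‖f₀.dx‖ ^ 2 / 2 - G 0 / 4 * quartic (free 0 f₀) + (b ^ 2 + 1) with hF₀
  have hm0 : 0 ≤ m := norm_nonneg _
  have hL0 : 0 ≤ L := by positivity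
  refine ⟨m + (4 * (|F₀| * Real.exp (L * |T|)) + 1), fun τ hτ α hα0 hα t ht => ?_⟩
  have hmass : ∀ s ∈ Set.Ioo (-τ) τ, ‖(α s).fn‖ = m := by
    intro s hs
    have h0 := abs_le_exp_of_abs_deriv_le (F := fun s => ‖(α s).fn‖ ^ 2 - m ^ 2) (F' := fun _ => 0)
      (L := 0) (fun s hs => (hasDerivAt_mass (hα s hs)).sub_const _) (by simp) s hs
    rw [hα0, ← hm, sub_self, abs_zero, zero_mul] at h0
    have := sub_eq_zero.1 (abs_nonpos_iff.1 h0)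
    exact (sq_eq_sq₀ (norm_nonneg _) hm0).1 this
  have hsub : ∀ s ∈ Set.Ioo (-τ) τ, s ∈ Set.Icc (-T) T := fun s hs =>
    ⟨by linarith [hs.1], by linarith [hs.2]⟩
  have hV : ∀ s ∈ Set.Ioo (-τ) τ, |quartic (free s (α s))| ≤ 2 * m ^ 3 * ‖(α s).dx‖ := by
    intro s hs
    have := abs_quartic_le (free s (α s))
    rwa [free_fn, free_dx, norm_freeL2, norm_freeL2, hmass s hs] at this
  set F : ℝ → ℝ := fun s =>
    ‖(α s).dx‖ ^ 2 / 2 - G s / 4 * quartic (free s (α s)) + (b ^ 2 + 1) with hF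
  have hFlow : ∀ s ∈ Set.Ioo (-τ) τ, ‖(α s).dx‖ ^ 2 / 4 + 1 ≤ F s := by
    intro s hs
    have h1 : |G s / 4 * quartic (free s (α s))| ≤ b * ‖(α s).dx‖ := by
      rw [abs_mul, abs_div, abs_of_pos (show (0 : ℝ) < 4 by norm_num)]
      calc |G s| / 4 * |quartic (free s (α s))|
          ≤ |M₀| / 4 * (2 * m ^ 3 * ‖(α s).dx‖) :=
            mul_le_mul (div_le_div_of_nonneg_right
              ((hM₀ s (hsub s hs)).trans (le_abs_self _)) (by norm_num)) (hV s hs)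
              (abs_nonneg _) (by positivity)
        _ = _ := by rw [hb]; ring
    have h2 := (abs_le.1 h1).2
    have h3 := sq_nonneg (‖(α s).dx‖ / 2 - b)
    simp only [hF]
    nlinarith
  have hFd : ∀ s ∈ Set.Ioo (-τ) τ,
      |-(G' s / 4) * quartic (free s (α s))| ≤ L * |F s| := by
    intro s hs
    have h1 : |-(G' s / 4) * quartic (free s (α s))| ≤ L * ‖(α s).dx‖ := by
      rw [abs_mul, abs_neg, abs_div, abs_of_pos (show (0 : ℝ) < 4 by norm_num)]
      calc |G' s| / 4 * |quartic (free s (α s))|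
          ≤ |M₁| / 4 * (2 * m ^ 3 * ‖(α s).dx‖) :=
            mul_le_mul (div_le_div_of_nonneg_right
              ((hM₁ s (hsub s hs)).trans (le_abs_self _)) (by norm_num)) (hV s hs)
              (abs_nonneg _) (by positivity)
        _ = _ := by rw [hL]; ring
    refine h1.trans (mul_le_mul_of_nonneg_left ?_ hL0)
    have h2 := hFlow s hs
    have h3 := le_abs_self (F s)
    nlinarith [sq_nonneg (‖(α s).dx‖ / 2 - 1)]
  have hgr := abs_le_exp_of_abs_deriv_le
    (fun s hs => (hasDerivAt_energy (hG s) (hα s hs)).add_const (b ^ 2 + 1)) hFd t ht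
  have hF0 : F 0 = F₀ := by simp only [hF, hF₀, hα0]
  have hexp : |F t| ≤ |F₀| * Real.exp (L * |T|) := by
    refine hgr.trans ?_
    change |F 0| * _ ≤ _
    rw [hF0]
    have habs : |t| ≤ |T| := (abs_lt.2 ht).le.trans (hτ.trans (le_abs_self T))
    exact mul_le_mul_of_nonneg_left (Real.exp_le_exp.2 (mul_le_mul_of_nonneg_left habs hL0))
      (abs_nonneg _)
  have h1 := hFlow t ht
  have h2 := le_abs_self (F t)
  have h3 := norm_le_add (α t)
  rw [hmass t ht] at h3
  have h4 : ‖(α t).dx‖ ≤ ‖(α t).dx‖ ^ 2 + 1 := by nlinarith [sq_nonneg (‖(α t).dx‖ - 1)]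
  linarith

/-- Global well-posedness in `H¹(ℝ)` of `i φ_t = -φ_xx - G(t) |φ|² φ`. -/
theorem exists_global_nls {G G' : ℝ → ℝ} (hG : ∀ t, HasDerivAt G (G' t) t)
    (hG' : Continuous G') (f₀ : H1) :
    ∃ φ : ℝ → H1, Continuous φ ∧ (∀ t, ‖(φ t).fn‖ = ‖f₀.fn‖) ∧
      ∀ (t : ℝ) (w : H1), HasDerivAt (fun s => inner ℂ w.fn (φ s).fn)
        (-Complex.I * inner ℂ w.dx (φ t).dx
          + Complex.I * G t * inner ℂ w.fn (cubic (φ t)).fn) t := by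
  have hGc : Continuous G := continuous_iff_continuousAt.2 fun t => (hG t).continuousAt
  obtain ⟨α, hα0, hα⟩ := exists_global_of_apriori_bound (exists_lipschitz_nlsField hGc)
    (continuous_nlsField hGc) (exists_apriori_bound hG hG' f₀)
  refine ⟨fun t => free t (α t), continuous_iff_continuousAt.2 fun t =>
    continuousAt_free_trajectory (hα t).continuousAt, fun t => ?_, fun t w =>
    hasDerivAt_inner_trajectory (hα t) w⟩
  have hc := is_const_of_deriv_eq_zero (fun s => (hasDerivAt_mass (hα s)).differentiableAt)
    (fun s => (hasDerivAt_mass (hα s)).deriv) t 0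
  rw [free_fn, norm_freeL2, ← hα0]
  exact (sq_eq_sq₀ (norm_nonneg _) (norm_nonneg _)).1 hc

end H1

/-! ### Growing solutions in the broken phase -/

theorem exists_H1_fn_ne_zero : ∃ f : H1, f.fn ≠ 0 := by
  let χ : ContDiffBump (0 : ℝ) := default
  have h1 : HasCompactSupport fun x => (χ x : ℂ) := χ.hasCompactSupport.comp_left Complex.ofReal_zero
  have h2 : ContDiff ℝ (⊤ : ℕ∞) fun x => (χ x : ℂ) := Complex.ofRealCLM.contDiff.comp χ.contDiff
  refine ⟨schwartzH1 (h1.toSchwartzMap h2), fun h => ?_⟩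
  rw [schwartzH1_fn] at h
  have h0 : h1.toSchwartzMap h2 = 0 :=
    SchwartzMap.injective_toLp 2 volume (h.trans (map_zero (SchwartzMap.toLpCLM ℂ ℂ 2 volume)).symm)
  have h3 : (h1.toSchwartzMap h2) 0 = 0 := by rw [h0]; rfl
  have h4 : (χ (0 : ℝ) : ℂ) = 0 := h3
  rw [χ.one_of_mem_closedBall (Metric.mem_closedBall_self χ.rIn_pos.le)] at h4
  norm_num at h4

/-- A solution `(a, b)` of the linear `x`-independent system, multiplied with a solution of a scalar
cubic equation, solves the Manakov system. -/
theorem exists_globalSolution_of_linear (g κ γ : ℝ) {a b : ℝ → ℂ}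
    (ha : ∀ t, HasDerivAt a (-Complex.I * κ * b t + γ * a t) t)
    (hb : ∀ t, HasDerivAt b (-Complex.I * κ * a t - γ * b t) t) (f₀ : H1) :
    ∃ u v : ℝ → H1, IsGlobalSolution g g g κ γ u v ∧
      ∀ t, totalPower (u t) (v t) = (‖a t‖ ^ 2 + ‖b t‖ ^ 2) * ‖f₀.fn‖ ^ 2 := by
  have hac : Continuous a := continuous_iff_continuousAt.2 fun t => (ha t).continuousAt
  have hbc : Continuous b := continuous_iff_continuousAt.2 fun t => (hb t).continuousAt
  -- For `(a φ, b φ)` both components see the potential `g (|a|² + |b|²) |φ|²`, which makes the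
  -- equations for `φ` coincide.
  let G : ℝ → ℝ := fun t => g * (‖a t‖ ^ 2 + ‖b t‖ ^ 2)
  have hG : ∀ t, HasDerivAt G (g * (2 * inner ℝ (a t) (-Complex.I * κ * b t + γ * a t)
      + 2 * inner ℝ (b t) (-Complex.I * κ * a t - γ * b t))) t := fun t =>
    (((ha t).norm_sq).add ((hb t).norm_sq)).const_mul g
  obtain ⟨φ, hφc, hφm, hφ⟩ := H1.exists_global_nls hG (by fun_prop) f₀
  have hint : ∀ (c : ℂ) (t : ℝ) (w : H1),
      ∫ x : ℝ, ((g * ‖(a t • φ t).fn x‖ ^ 2 + g * ‖(b t • φ t).fn x‖ ^ 2 : ℝ) : ℂ)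
            * (c • φ t).fn x * conj (w.fn x)
      = c * G t * inner ℂ w.fn (H1.cubic (φ t)).fn := by
    intro c t w
    rw [inner_L2, ← integral_const_mul]
    refine integral_congr_ae ?_
    simp only [H1.fn_smul]
    filter_upwards [Lp.coeFn_smul (a t) (φ t).fn, Lp.coeFn_smul (b t) (φ t).fn,
      Lp.coeFn_smul c (φ t).fn, H1.cubic_fn_coe (φ t)] with x h1 h2 h3 h4
    rw [h1, h2, h3, h4]
    simp only [Pi.smul_apply, smul_eq_mul, norm_mul, G]
    push_cast
    ring
  refine ⟨fun t => a t • φ t, fun t => b t • φ t,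
    ⟨hac.smul hφc, hbc.smul hφc, fun t w => ?_, fun t w => ?_⟩, fun t => ?_⟩
  · simp only [hint]
    simp only [H1.fn_smul, H1.dx_smul, inner_smul_right]
    refine (((ha t).mul (hφ t w)).const_mul Complex.I).congr_deriv ?_
    linear_combination (-κ * b t * inner ℂ w.fn (φ t).fn
      - a t * inner ℂ w.dx (φ t).dx + a t * G t * inner ℂ w.fn (H1.cubic (φ t)).fn) * Complex.I_sq
  · simp only [hint]
    simp only [H1.fn_smul, H1.dx_smul, inner_smul_right]
    refine (((hb t).mul (hφ t w)).const_mul Complex.I).congr_deriv ?_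
    linear_combination (-κ * a t * inner ℂ w.fn (φ t).fn
      - b t * inner ℂ w.dx (φ t).dx + b t * G t * inner ℂ w.fn (H1.cubic (φ t)).fn) * Complex.I_sq
  · rw [totalPower, H1.fn_smul, H1.fn_smul, norm_smul, norm_smul, hφm]
    ring

/-- At and above the symmetry-breaking threshold the linear system has growing solutions. -/
theorem exists_growing_linear {κ γ : ℝ} (hκ : 0 ≤ κ) (hle : κ ≤ γ) (hγ : 0 < γ) :
    ∃ a b : ℝ → ℂ, (∀ t, HasDerivAt a (-Complex.I * κ * b t + γ * a t) t) ∧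
      (∀ t, HasDerivAt b (-Complex.I * κ * a t - γ * b t) t) ∧
      Tendsto (fun t => ‖a t‖ ^ 2 + ‖b t‖ ^ 2) atTop atTop := by
  rcases hle.eq_or_lt with rfl | hlt
  -- At `κ = γ` the matrix of the system is nonzero and nilpotent, so solutions grow linearly.
  · refine ⟨fun t => ((1 + κ * t : ℝ) : ℂ), fun t => -Complex.I * ((κ * t : ℝ) : ℂ),
      fun t => ?_, fun t => ?_, ?_⟩
    · have h : HasDerivAt (fun t : ℝ => 1 + κ * t) (κ * 1) t :=
        ((hasDerivAt_id t).const_mul κ).const_add 1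
      refine h.ofReal_comp.congr_deriv ?_
      push_cast
      linear_combination -κ ^ 2 * t * Complex.I_sq
    · have h : HasDerivAt (fun t : ℝ => κ * t) (κ * 1) t := (hasDerivAt_id t).const_mul κ
      refine (h.ofReal_comp.const_mul (-Complex.I)).congr_deriv ?_
      push_cast
      ring
    · have h : Tendsto (fun t : ℝ => 1 + κ * t) atTop atTop :=
        tendsto_atTop_add_const_left _ _ (tendsto_id.const_mul_atTop hγ)
      refine tendsto_atTop_mono' _ ?_ h
      filter_upwards [eventually_ge_atTop 0] with t ht
      have h1 : 0 ≤ κ * t := by positivity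
      have h2 := sq_nonneg ‖-Complex.I * ((κ * t : ℝ) : ℂ)‖
      rw [Complex.norm_real, Real.norm_of_nonneg (by linarith)]
      nlinarith
  · set μ := √(γ ^ 2 - κ ^ 2) with hμ
    have hpos : 0 < γ ^ 2 - κ ^ 2 := by nlinarith
    have hμ2 : μ ^ 2 = γ ^ 2 - κ ^ 2 := Real.sq_sqrt hpos.le
    have hμ0 : 0 < μ := Real.sqrt_pos.2 hpos
    have hne : (μ + γ : ℂ) ≠ 0 := by
      have : μ + γ ≠ 0 := by positivity
      exact_mod_cast this
    have hμ2' : (μ : ℂ) ^ 2 = γ ^ 2 - κ ^ 2 := by exact_mod_cast hμ2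
    have h : ∀ t : ℝ, HasDerivAt (fun t : ℝ => (Real.exp (μ * t) : ℂ)) (μ * Real.exp (μ * t) : ℂ) t := by
      intro t
      have h1 : HasDerivAt (fun t : ℝ => μ * t) (μ * 1) t := (hasDerivAt_id t).const_mul μ
      refine h1.exp.ofReal_comp.congr_deriv ?_
      push_cast
      ring
    -- Eigenvector for the positive eigenvalue `μ = √(γ² - κ²)`, written with the denominator `μ +
    -- γ` so that `κ = 0` is covered.
    refine ⟨fun t => (Real.exp (μ * t) : ℂ),
      fun t => -Complex.I * κ / (μ + γ) * (Real.exp (μ * t) : ℂ), fun t => ?_, fun t => ?_, ?_⟩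
    · refine (h t).congr_deriv ?_
      field_simp
      linear_combination hμ2' - κ ^ 2 * Complex.I_sq
    · refine ((h t).const_mul _).congr_deriv ?_
      field_simp
      ring
    · have h1 : Tendsto (fun t : ℝ => Real.exp (μ * t)) atTop atTop :=
        Real.tendsto_exp_atTop.comp (tendsto_id.const_mul_atTop hμ0)
      refine tendsto_atTop_mono' _ ?_ h1
      filter_upwards [eventually_ge_atTop 0] with t ht
      have h2 : 1 ≤ Real.exp (μ * t) := Real.one_le_exp (by positivity)
      have h3 := sq_nonneg ‖-Complex.I * κ / (μ + γ) * (Real.exp (μ * t) : ℂ)‖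
      rw [Complex.norm_real, Real.norm_of_nonneg (Real.exp_pos _).le]
      nlinarith

theorem theorem2 (g₁₁ g₁₂ g₂₂ κ γ : ℝ) (hg₁ : g₁₁ = g₂₂) (hg₂ : g₂₂ = g₁₂)
    (hκ : 0 ≤ κ) (hγ : 0 ≤ γ) :
    (γ < κ → ∀ u v : ℝ → H1, IsGlobalSolution g₁₁ g₁₂ g₂₂ κ γ u v →
      (∃ Q : ℝ, 0 < Q ∧ ∀ t : ℝ, totalPower (u t) (v t) ≤ Q) ∧
      (∀ t : ℝ, totalPower (u t) (v t) ≤ Qmax κ γ (u 0) (v 0))) ∧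
    (κ ≤ γ → 0 < γ → ∃ u v : ℝ → H1, IsGlobalSolution g₁₁ g₁₂ g₂₂ κ γ u v ∧
      Tendsto (fun t : ℝ => totalPower (u t) (v t)) atTop atTop) := by
  subst hg₁ hg₂
  refine ⟨fun hlt u v h => ?_, fun hle hpos => ?_⟩
  · have hb := h.totalPower_le hγ hlt
    -- The maximum with 1 secures positivity, since `Qmax` vanishes for zero data.
    exact ⟨⟨max 1 (Qmax κ γ (u 0) (v 0)), lt_max_of_lt_left one_pos,
      fun t => (hb t).trans (le_max_right _ _)⟩, hb⟩
  · obtain ⟨f₀, hf₀⟩ := exists_H1_fn_ne_zero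
    obtain ⟨a, b, ha, hb, hab⟩ := exists_growing_linear hκ hle hpos
    obtain ⟨u, v, h, hQ⟩ := exists_globalSolution_of_linear g₁₁ κ γ ha hb f₀
    refine ⟨u, v, h, ?_⟩
    simp only [hQ]
    exact hab.atTop_mul_const (by positivity)
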